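/- Let $X_1,X_2,\dots$ be independent, identically distributed integer-valued random variables with mean $\mathbb{E}X_1=0$ and finite variance $V$, and let $S_n=X_1+\cdots+X_n$, with $S_0=0$. Suppose that the walk has no periodicity, that is, $\mathbb{P}(S_n=1)>0$ for some $n$, and the greatest common divisor of the times $n\ge 1$ with $\mathbb{P}(S_n=0)>0$ is $1$. Let $\tau=\min\{k\ge 1: S_k=0\}$ (with $\tau=\infty$ if there is no such $k$) be the time of the first return to the origin, and let $a_n=\mathbb{P}(\tau=n)$. Then, as $n\to\infty$, $$a_n\sim\sqrt{\frac{V}{2\pi}}\;n^{-3/2}.$$ -/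

import Mathlib

open MeasureTheory ProbabilityTheory Filter Asymptotics

noncomputable section

/-- The random walk `S n = X 0 + ⋯ + X (n - 1)` on `ℤ` with increments `X 0, X 1, …`,
started at the origin. -/
def walk {Ω : Type*} (X : ℕ → Ω → ℤ) (n : ℕ) (ω : Ω) : ℤ :=
  ∑ j ∈ Finset.range n, X j ω

/-- The first return time to the origin, `τ = min {k ≥ 1 : S k = 0}`, with value `⊤` when the walk
never returns. -/
def firstReturnTime {Ω : Type*} (X : ℕ → Ω → ℤ) (ω : Ω) : ℕ∞ :=
  ⨅ (k : ℕ) (_ : 1 ≤ k ∧ walk X k ω = 0), (k : ℕ∞)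

/-- The probability `a n = P (τ = n)` that the first return to the origin occurs at time `n`. -/
def firstReturnProb {Ω : Type*} [MeasurableSpace Ω] (μ : Measure Ω) (X : ℕ → Ω → ℤ) (n : ℕ) : ℝ :=
  μ.real {ω | firstReturnTime X ω = n}

/-- The set of times `n` at which it is possible (has positive probability) that `S n = x`. -/
def possibleTimes {Ω : Type*} [MeasurableSpace Ω] (μ : Measure Ω) (X : ℕ → Ω → ℤ) (x : ℤ) : Set ℕ :=
  {n | 0 < μ {ω | walk X n ω = x}}

/-- The walk has no periodicity: the site `1` can be reached (so that the walk does not live on a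
proper sublattice), and the greatest common divisor of the possible return times to the
origin is `1`. (The time `0` belongs to `possibleTimes μ X 0` and does not affect the gcd.) -/
structure NoPeriodicity {Ω : Type*} [MeasurableSpace Ω] (μ : Measure Ω) (X : ℕ → Ω → ℤ) :
    Prop where
  reaches_one : (possibleTimes μ X 1).Nonempty
  gcd_returns : Nat.setGcd (possibleTimes μ X 0) = 1

end

/-! Let `φ` be the characteristic function of a step, `u n = P (S n = 0)`, and `U`, `A` the
generating functions of `u` and `a`. Fourier inversion gives `u n = (2 π)⁻¹ ∫ φ ^ n` over a period,
so `2 π U(s) = ∫ 1 / (1 - s φ)` for `‖s‖ < 1`. Splitting at the first return gives `A U = U - 1`,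
that is `A = 1 - 1 / U`.

With `b = V / 2`, the expansion `φ θ = 1 - b θ ^ 2 + o(θ ^ 2)` makes `U` behave like `(1 - s) ^
(-1/2) / (2 √b)` near `1`, so formally `A ≈ 1 - 2 √b √(1 - s)` and `A'' ≈ (√b / 2) (1 - s) ^
(-3/2)`. Only second moments are available, so nothing is continued beyond the disc. Instead `a n`
is read off as a Fourier coefficient on the circle of radius `exp (-1 / n)`. Two integrations by
parts (`mul_pred_mul_coeff_eq`) express `n (n - 1) a n` through `A''`. Two are needed because the
bound `‖A''‖ ≤ C ‖1 - s‖ ^ (-3/2)` (`exists_norm_returnGFDeriv₂_le`) decays integrably once angles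
are scaled by `1 / n`, while a bound of order `-1/2` for `A'` would not.

Dominated convergence (`tendsto_integral_returnGFDeriv₂`) leaves `∫ (1 - i x) ^ (-3/2) e ^ (-i x)
dx`, which Fourier inversion of `√v e ^ (-v)` evaluates. The two non-periodicity hypotheses enter
through `‖φ θ‖ < 1` for `0 < |θ| ≤ π` (`norm_charFun_lt`), which makes `s = 1` the only singular
point of the closed disc. -/

/-! ### Bounds for the symbol near and away from the origin -/

section Symbol

open Real Topology

/-- A continuous function `φ` on `ℝ` with `φ θ = 1 - b θ ^ 2 + o(θ ^ 2)` at the origin, of modulus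
less than `1` at the other points of `[-π, π]`. -/
structure IsAperiodicSymbol (φ : ℝ → ℂ) (b : ℝ) : Prop where
  continuous : Continuous φ
  pos : 0 < b
  norm_lt : ∀ θ ∈ Set.Icc (-π) π, θ ≠ 0 → ‖φ θ‖ < 1
  taylor : (fun θ : ℝ => φ θ - (1 - (b : ℂ) * (θ : ℂ) ^ 2)) =o[𝓝 0] fun θ : ℝ => θ ^ 2

namespace IsAperiodicSymbol

variable {φ : ℝ → ℂ} {b : ℝ}

lemma map_zero (h : IsAperiodicSymbol φ b) : φ 0 = 1 := by
  have := (h.taylor.def (c := 1) one_pos).self_of_nhds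
  simp only [Complex.ofReal_zero, ne_eq, OfNat.ofNat_ne_zero, not_false_eq_true, zero_pow,
    mul_zero, sub_zero, norm_zero] at this
  exact sub_eq_zero.1 (norm_le_zero_iff.1 this)

lemma norm_le (h : IsAperiodicSymbol φ b) {θ : ℝ} (hθ : θ ∈ Set.Icc (-π) π) : ‖φ θ‖ ≤ 1 := by
  rcases eq_or_ne θ 0 with rfl | h0
  · simp [h.map_zero]
  · exact (h.norm_lt θ hθ h0).le

/-- The Taylor expansion gives the bound near `0`; on the rest of the period `1 - ‖φ‖` has a
positive minimum by compactness. -/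
lemma exists_le_one_sub_norm (h : IsAperiodicSymbol φ b) :
    ∃ c > 0, ∀ θ ∈ Set.Icc (-π) π, c * θ ^ 2 ≤ 1 - ‖φ θ‖ := by
  have hb := h.pos
  obtain ⟨δ, hδ, hδ'⟩ := Metric.eventually_nhds_iff.1 (h.taylor.def (c := b / 2) (by positivity))
  -- The cap `1 / √b` keeps `1 - b θ ^ 2` nonnegative, hence equal to its own norm.
  set δ' := min δ (1 / √b) with hδ'_def
  have hδ'0 : 0 < δ' := lt_min hδ (by positivity)
  have near : ∀ θ : ℝ, |θ| < δ' → b / 2 * θ ^ 2 ≤ 1 - ‖φ θ‖ := by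
    intro θ hθ
    have h1 := hδ' (y := θ) (by simpa using hθ.trans_le (min_le_left _ _))
    have h2 : b * θ ^ 2 ≤ 1 := by
      have h3 : |θ| ≤ 1 / √b := hθ.le.trans (min_le_right _ _)
      have h4 : θ ^ 2 ≤ (1 / √b) ^ 2 := by
        rw [← sq_abs]; gcongr
      rw [div_pow, Real.sq_sqrt hb.le, one_pow] at h4
      calc b * θ ^ 2 ≤ b * (1 / b) := by gcongr
        _ = 1 := by field_simp
    have h5 : ‖(1 : ℂ) - (b : ℂ) * (θ : ℂ) ^ 2‖ = 1 - b * θ ^ 2 := by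
      rw [show (1 : ℂ) - (b : ℂ) * (θ : ℂ) ^ 2 = ((1 - b * θ ^ 2 : ℝ) : ℂ) by push_cast; ring,
        Complex.norm_real, Real.norm_of_nonneg (by linarith)]
    have h6 : ‖φ θ‖ ≤ ‖φ θ - (1 - (b : ℂ) * (θ : ℂ) ^ 2)‖ + ‖(1 : ℂ) - (b : ℂ) * (θ : ℂ) ^ 2‖ := 
      norm_le_norm_sub_add _ _
    rw [Real.norm_of_nonneg (sq_nonneg θ)] at h1
    linarith
  set K := Set.Icc (-π) π ∩ {θ : ℝ | δ' ≤ |θ|} with hK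
  have hKc : IsCompact K :=
    isCompact_Icc.inter_right (isClosed_le continuous_const continuous_abs)
  obtain ⟨c, hc, hcK⟩ : ∃ c > 0, ∀ θ ∈ K, c ≤ 1 - ‖φ θ‖ := by
    rcases K.eq_empty_or_nonempty with he | hne
    · exact ⟨1, one_pos, by simp [he]⟩
    · obtain ⟨x, hx, hmin⟩ := hKc.exists_isMinOn hne
        (f := fun θ => 1 - ‖φ θ‖) (by have := h.continuous; fun_prop)
      refine ⟨1 - ‖φ x‖, ?_, fun θ hθ => hmin hθ⟩
      have : x ≠ 0 := by
        rintro rfl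
        have := hx.2
        simp only [Set.mem_ofPred_eq, abs_zero] at this
        linarith
      linarith [h.norm_lt x hx.1 this]
  refine ⟨min (b / 2) (c / π ^ 2), by positivity, fun θ hθ => ?_⟩
  rcases lt_or_ge |θ| δ' with h1 | h1
  · exact (mul_le_mul_of_nonneg_right (min_le_left _ _) (sq_nonneg _)).trans (near θ h1)
  · refine le_trans ?_ (hcK θ ⟨hθ, h1⟩)
    have : θ ^ 2 ≤ π ^ 2 := sq_le_sq' hθ.1 hθ.2
    calc min (b / 2) (c / π ^ 2) * θ ^ 2 ≤ c / π ^ 2 * π ^ 2 := by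
          gcongr; exact min_le_right _ _
      _ = c := by field_simp

lemma exists_norm_one_sub_le (h : IsAperiodicSymbol φ b) :
    ∃ C > 0, ∀ θ ∈ Set.Icc (-π) π, ‖1 - φ θ‖ ≤ C * θ ^ 2 := by
  have hb := h.pos
  obtain ⟨δ, hδ, hδ'⟩ := Metric.eventually_nhds_iff.1 (h.taylor.def (c := 1) one_pos)
  refine ⟨max (b + 1) (2 / δ ^ 2), by positivity, fun θ hθ => ?_⟩
  rcases lt_or_ge |θ| δ with h1 | h1
  · have h2 := hδ' (y := θ) (by simpa using h1)
    have h3 : ‖1 - φ θ‖ ≤ ‖φ θ - (1 - (b : ℂ) * (θ : ℂ) ^ 2)‖ + ‖(b : ℂ) * (θ : ℂ) ^ 2‖ := by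
      rw [show 1 - φ θ = -(φ θ - (1 - (b : ℂ) * (θ : ℂ) ^ 2)) + (b : ℂ) * (θ : ℂ) ^ 2 by ring]
      exact (norm_add_le _ _).trans_eq (by rw [norm_neg])
    rw [Real.norm_of_nonneg (sq_nonneg θ)] at h2
    have h4 : ‖(b : ℂ) * (θ : ℂ) ^ 2‖ = b * θ ^ 2 := by
      simp [abs_of_pos hb]
    calc ‖1 - φ θ‖ ≤ (b + 1) * θ ^ 2 := by linarith
      _ ≤ _ := by gcongr; exact le_max_left _ _
  · have h2 : ‖1 - φ θ‖ ≤ 2 := by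
      refine (norm_sub_le _ _).trans ?_
      rw [norm_one]; linarith [h.norm_le hθ]
    have h3 : δ ^ 2 ≤ θ ^ 2 := by rw [← sq_abs θ]; gcongr
    calc ‖1 - φ θ‖ ≤ 2 / δ ^ 2 * δ ^ 2 := by rw [div_mul_cancel₀ _ (by positivity)]; exact h2
      _ ≤ _ := by gcongr; exact le_max_right _ _

/-- The basic lower bound for denominators, uniform on the closed disc. The quantity `‖1 - s φ‖ ≥ 1
- ‖φ‖` controls `θ ^ 2`; then `1 - s = (1 - s φ) - s (1 - φ)` shows that it controls `‖1 - s‖` as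
well. -/
lemma exists_le_norm_one_sub_mul (h : IsAperiodicSymbol φ b) :
    ∃ κ > 0, ∀ s : ℂ, ‖s‖ ≤ 1 → ∀ θ ∈ Set.Icc (-π) π,
      κ * (‖1 - s‖ + θ ^ 2) ≤ ‖1 - s * φ θ‖ := by
  obtain ⟨c, hc, hlow⟩ := h.exists_le_one_sub_norm
  obtain ⟨C, hC, hup⟩ := h.exists_norm_one_sub_le
  refine ⟨1 / (1 + (1 + C) / c), by positivity, fun s hs θ hθ => ?_⟩
  have h1 : c * θ ^ 2 ≤ ‖1 - s * φ θ‖ := by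
    have h2 : ‖s * φ θ‖ ≤ ‖φ θ‖ := by
      rw [norm_mul]; exact mul_le_of_le_one_left (norm_nonneg _) hs
    have h3 := norm_sub_norm_le 1 (s * φ θ)
    rw [norm_one] at h3
    linarith [hlow θ hθ]
  have h2 : ‖1 - s‖ ≤ ‖1 - s * φ θ‖ + C * θ ^ 2 := by
    rw [show 1 - s = (1 - s * φ θ) - s * (1 - φ θ) by ring]
    refine (norm_sub_le _ _).trans ?_
    gcongr
    rw [norm_mul]
    exact (mul_le_of_le_one_left (norm_nonneg _) hs).trans (hup θ hθ)
  rw [div_mul_eq_mul_div, one_mul, div_le_iff₀ (by positivity)]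
  have h3 : θ ^ 2 ≤ ‖1 - s * φ θ‖ / c := by rw [le_div_iff₀ hc]; linarith
  calc ‖1 - s‖ + θ ^ 2 ≤ ‖1 - s * φ θ‖ + (1 + C) * θ ^ 2 := by linarith
    _ ≤ ‖1 - s * φ θ‖ + (1 + C) * (‖1 - s * φ θ‖ / c) := by gcongr
    _ = _ := by ring

end IsAperiodicSymbol

end Symbol

/-! ### Integrals of the resolvent over a period: derivatives and size -/

section Lattice

open Real Topology

lemma integrable_inv_add_mul_sq {a b : ℝ} (ha : 0 < a) (hb : 0 < b) :
    Integrable fun x : ℝ => (a + b * x ^ 2)⁻¹ := by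
  have h := (integrable_inv_one_add_sq.comp_mul_left' (R := √(b / a)) (by positivity)).const_mul a⁻¹
  refine h.congr (.of_forall fun x => ?_)
  simp only [mul_pow]
  rw [Real.sq_sqrt (by positivity)]
  field_simp

lemma integral_inv_add_mul_sq {a b : ℝ} (ha : 0 < a) (hb : 0 < b) :
    ∫ x : ℝ, (a + b * x ^ 2)⁻¹ = π / (√a * √b) := by
  have h1 : ∀ x : ℝ, (a + b * x ^ 2)⁻¹ = a⁻¹ * (1 + (√(b / a) * x) ^ 2)⁻¹ := fun x => by
    rw [mul_pow, Real.sq_sqrt (by positivity)]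
    field_simp
  simp_rw [h1]
  rw [integral_const_mul, Measure.integral_comp_mul_left (fun x => (1 + x ^ 2)⁻¹),
    integral_univ_inv_one_add_sq, abs_of_pos (by positivity), Real.sqrt_div hb.le, smul_eq_mul]
  have := Real.sq_sqrt ha.le
  field_simp
  exact this

/-- The integral of `φ ^ k / (1 - s φ) ^ (k + 1)` over a period. -/
noncomputable def latticeIntegral (φ : ℝ → ℂ) (k : ℕ) (s : ℂ) : ℂ :=
  ∫ θ in (-π)..π, φ θ ^ k / (1 - s * φ θ) ^ (k + 1)

namespace IsAperiodicSymbol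

variable {φ : ℝ → ℂ} {b : ℝ}

lemma one_sub_norm_le (h : IsAperiodicSymbol φ b) {s : ℂ} {θ : ℝ} (hθ : θ ∈ Set.Icc (-π) π) :
    1 - ‖s‖ ≤ ‖1 - s * φ θ‖ := by
  have h3 := norm_sub_norm_le 1 (s * φ θ)
  rw [norm_one, norm_mul] at h3
  linarith [mul_le_of_le_one_right (norm_nonneg s) (h.norm_le hθ)]

lemma one_sub_mul_ne_zero (h : IsAperiodicSymbol φ b) {s : ℂ} (hs : ‖s‖ < 1) {θ : ℝ}
    (hθ : θ ∈ Set.Icc (-π) π) : 1 - s * φ θ ≠ 0 :=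
  norm_pos_iff.1 (by linarith [h.one_sub_norm_le (s := s) hθ])

lemma continuousOn_integrand (h : IsAperiodicSymbol φ b) (k : ℕ) {s : ℂ} (hs : ‖s‖ < 1) :
    ContinuousOn (fun θ => φ θ ^ k / (1 - s * φ θ) ^ (k + 1)) (Set.Icc (-π) π) := by
  have := h.continuous
  refine ContinuousOn.div (by fun_prop) (by fun_prop) fun θ hθ => ?_
  exact pow_ne_zero _ (h.one_sub_mul_ne_zero hs hθ)

lemma intervalIntegrable_integrand (h : IsAperiodicSymbol φ b) (k : ℕ) {s : ℂ} (hs : ‖s‖ < 1) :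
    IntervalIntegrable (fun θ => φ θ ^ k / (1 - s * φ θ) ^ (k + 1)) volume (-π) π := by
  refine ContinuousOn.intervalIntegrable ?_
  rw [Set.uIcc_of_le (by linarith [Real.pi_pos])]
  exact h.continuousOn_integrand k hs

/-- Differentiation under the integral sign; the powers are chosen so that the family is closed
under `d/ds`, up to the factor `k + 1`. -/
lemma hasDerivAt_latticeIntegral (h : IsAperiodicSymbol φ b) (k : ℕ) {s : ℂ} (hs : ‖s‖ < 1) :
    HasDerivAt (latticeIntegral φ k) ((k + 1) * latticeIntegral φ (k + 1) s) s := by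
  have hpi := Real.pi_pos
  -- A radius strictly between `‖s‖` and `1`, on whose disc the denominators are bounded below by `1
  -- - ρ`.
  set ρ := (1 + ‖s‖) / 2 with hρ
  have hρ1 : ρ < 1 := by rw [hρ]; linarith
  have hsρ : ‖s‖ < ρ := by rw [hρ]; linarith
  have hball : Metric.ball (0 : ℂ) ρ ∈ 𝓝 s := Metric.isOpen_ball.mem_nhds (by simpa using hsρ)
  have hsub : ∀ θ : ℝ, θ ∈ Set.uIoc (-π) π → θ ∈ Set.Icc (-π) π := fun θ hθ => by
    rw [Set.uIoc_of_le (by linarith)] at hθ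
    exact Set.Ioc_subset_Icc_self hθ
  have key := intervalIntegral.hasDerivAt_integral_of_dominated_loc_of_deriv_le (μ := volume)
    (F := fun s θ => φ θ ^ k / (1 - s * φ θ) ^ (k + 1))
    (F' := fun s θ => (k + 1) * (φ θ ^ (k + 1) / (1 - s * φ θ) ^ (k + 1 + 1)))
    (bound := fun _ => (k + 1) * (1 / (1 - ρ) ^ (k + 1 + 1))) (a := -π) (b := π) (x₀ := s)
    hball ?_ (h.intervalIntegrable_integrand k hs)
    ((h.intervalIntegrable_integrand (k + 1) hs).const_mul _).def'.aestronglyMeasurable ?_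
    intervalIntegrable_const ?_
  · have := key.2
    rwa [intervalIntegral.integral_const_mul] at this
  · filter_upwards [hball] with z hz
    have hz' : ‖z‖ < 1 := (by simpa using hz : ‖z‖ < ρ).trans hρ1
    exact (h.intervalIntegrable_integrand k hz').def'.aestronglyMeasurable
  · refine .of_forall fun θ hθ z hz => ?_
    have hz' : ‖z‖ < ρ := by simpa using hz
    rw [norm_mul, norm_div, norm_pow, norm_pow]
    have h1 : ‖((k : ℂ) + 1)‖ = k + 1 := by
      rw [show ((k : ℂ) + 1) = ((k + 1 : ℝ) : ℂ) by push_cast; ring, Complex.norm_real,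
        Real.norm_of_nonneg (by positivity)]
    rw [h1]
    have h2 : 1 - ρ ≤ ‖1 - z * φ θ‖ := by linarith [h.one_sub_norm_le (s := z) (hsub θ hθ)]
    have h3 : 0 < 1 - ρ := by linarith
    gcongr
    exact pow_le_one₀ (norm_nonneg _) (h.norm_le (hsub θ hθ))
  · refine .of_forall fun θ hθ z hz => ?_
    have hz' : ‖z‖ < 1 := (by simpa using hz : ‖z‖ < ρ).trans hρ1
    have hne := h.one_sub_mul_ne_zero hz' (hsub θ hθ)
    have h1 : HasDerivAt (fun z : ℂ => 1 - z * φ θ) (-(φ θ)) z := by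
      simpa using ((hasDerivAt_id z).mul_const (φ θ)).const_sub 1
    have h2 := ((h1.pow (k + 1)).inv (pow_ne_zero _ hne)).const_mul (φ θ ^ k)
    convert! h2 using 1
    push_cast
    simp only [Pi.pow_apply]
    field_simp
    ring

/-- Each denominator is at least `κ (β + θ ^ 2)` with `β = ‖1 - s‖`. Bounding `k` of these factors
below by `κ β` leaves a Cauchy kernel, whose integral over the line is of order `β ^ (-1/2)`. -/
lemma exists_norm_latticeIntegral_le (h : IsAperiodicSymbol φ b) (k : ℕ) :
    ∃ C > 0, ∀ s : ℂ, ‖s‖ < 1 →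
      ‖latticeIntegral φ k s‖ ≤ C / (‖1 - s‖ ^ k * √‖1 - s‖) := by
  obtain ⟨κ, hκ, hlow⟩ := h.exists_le_norm_one_sub_mul
  have hpi := Real.pi_pos
  refine ⟨π / κ ^ (k + 1), by positivity, fun s hs => ?_⟩
  have hβ : 0 < ‖1 - s‖ := norm_pos_iff.2 (sub_ne_zero.2 (by rintro rfl; simp at hs))
  set β := ‖1 - s‖ with hβ_def
  have hpt : ∀ θ ∈ Set.Ioc (-π) π, ‖φ θ ^ k / (1 - s * φ θ) ^ (k + 1)‖
      ≤ (κ ^ (k + 1) * β ^ k)⁻¹ * (β + 1 * θ ^ 2)⁻¹ := fun θ hθ => by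
    have hθ' := Set.Ioc_subset_Icc_self hθ
    have h1 := hlow s hs.le θ hθ'
    rw [norm_div, norm_pow, norm_pow, ← mul_inv, ← one_div]
    gcongr
    · exact pow_le_one₀ (norm_nonneg _) (h.norm_le hθ')
    · calc κ ^ (k + 1) * β ^ k * (β + 1 * θ ^ 2)
          ≤ κ ^ (k + 1) * (β + θ ^ 2) ^ k * (β + θ ^ 2) := by
            rw [one_mul]; gcongr; nlinarith
        _ = (κ * (β + θ ^ 2)) ^ (k + 1) := by rw [mul_pow]; ring
        _ ≤ _ := by gcongr
  have hint := (integrable_inv_add_mul_sq hβ one_pos).const_mul (κ ^ (k + 1) * β ^ k)⁻¹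
  rw [latticeIntegral, intervalIntegral.integral_of_le (by linarith)]
  calc _ ≤ ∫ θ in Set.Ioc (-π) π, (κ ^ (k + 1) * β ^ k)⁻¹ * (β + 1 * θ ^ 2)⁻¹ :=
        norm_integral_le_of_norm_le hint.integrableOn
          ((ae_restrict_iff' measurableSet_Ioc).2 (.of_forall hpt))
    _ ≤ ∫ θ : ℝ, (κ ^ (k + 1) * β ^ k)⁻¹ * (β + 1 * θ ^ 2)⁻¹ :=
        setIntegral_le_integral hint (.of_forall fun θ => by positivity)
    _ = _ := by
        rw [integral_const_mul, integral_inv_add_mul_sq hβ one_pos]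
        simp only [Real.sqrt_one]
        field_simp

/-- No cancellation occurs in the real part: the integrand has real part `Re (1 - s φ) / ‖1 - s φ‖ ^
2 ≥ 0`. On the window `√β ≤ θ ≤ 2 √β` this is at least a constant over `β`, and the window has
length `√β`. -/
lemma exists_le_norm_latticeIntegral_zero (h : IsAperiodicSymbol φ b) :
    ∃ c > 0, ∀ s : ℂ, ‖s‖ < 1 → c / √‖1 - s‖ ≤ ‖latticeIntegral φ 0 s‖ := by
  obtain ⟨c, hc, hlow⟩ := h.exists_le_one_sub_norm
  obtain ⟨C, hC, hup⟩ := h.exists_norm_one_sub_le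
  have hpi := Real.pi_pos
  refine ⟨c / (1 + 4 * C) ^ 2, by positivity, fun s hs => ?_⟩
  have hβ : 0 < ‖1 - s‖ := norm_pos_iff.2 (sub_ne_zero.2 (by rintro rfl; simp at hs))
  have hβ2 : ‖1 - s‖ ≤ 2 := (norm_sub_le _ _).trans (by rw [norm_one]; linarith)
  set β := ‖1 - s‖ with hβ_def
  have hsq := Real.sq_sqrt hβ.le
  have hβpi : 2 * √β ≤ π := by
    -- Since `β ≤ 2 < 9 / 4`, the window ends at or before `3 < π`.
    have : √β ≤ 3 / 2 := Real.sqrt_le_iff.2 ⟨by norm_num, by linarith⟩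
    linarith [Real.pi_gt_three]
  have hβ0 : 0 < √β := Real.sqrt_pos.2 hβ
  have hre : ∀ θ ∈ Set.Icc (-π) π, c * θ ^ 2 ≤ (1 - s * φ θ).re := fun θ hθ => by
    have h1 : (s * φ θ).re ≤ ‖φ θ‖ := (Complex.re_le_norm _).trans (by
      rw [norm_mul]; exact mul_le_of_le_one_left (norm_nonneg _) hs.le)
    rw [Complex.sub_re, Complex.one_re]
    linarith [hlow θ hθ]
  have hii := h.intervalIntegrable_integrand 0 hs
  have hre_eq : ∀ θ : ℝ, (φ θ ^ 0 / (1 - s * φ θ) ^ (0 + 1)).re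
      = (1 - s * φ θ).re / ‖1 - s * φ θ‖ ^ 2 := fun θ => by
    rw [pow_zero, zero_add, pow_one, one_div, Complex.inv_re, Complex.sq_norm]
  have hii' : IntervalIntegrable (fun θ => (φ θ ^ 0 / (1 - s * φ θ) ^ (0 + 1)).re)
      volume (-π) π := ⟨hii.1.re, hii.2.re⟩
  have hcomm : (latticeIntegral φ 0 s).re
      = ∫ θ in (-π)..π, (φ θ ^ 0 / (1 - s * φ θ) ^ (0 + 1)).re :=
    (Complex.reCLM.intervalIntegral_comp_comm hii).symm
  have hsub : Set.uIcc (√β) (2 * √β) ⊆ Set.uIcc (-π) π := by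
    rw [Set.uIcc_of_le (by linarith), Set.uIcc_of_le (by linarith)]
    exact Set.Icc_subset_Icc (by linarith) hβpi
  calc c / (1 + 4 * C) ^ 2 / √β
      = ∫ θ in (√β)..(2 * √β), c / ((1 + 4 * C) ^ 2 * β) := by
        rw [intervalIntegral.integral_const, smul_eq_mul]
        nth_rewrite 4 [← hsq]
        field_simp
        ring
    _ ≤ ∫ θ in (√β)..(2 * √β), (φ θ ^ 0 / (1 - s * φ θ) ^ (0 + 1)).re := by
        refine intervalIntegral.integral_mono_on (by linarith) intervalIntegrable_const
          (hii'.mono_set hsub) fun θ hθ => ?_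
        have hθ' : θ ∈ Set.Icc (-π) π := ⟨by linarith [hθ.1], hθ.2.trans hβpi⟩
        have h1 : β ≤ θ ^ 2 := by rw [← hsq]; exact pow_le_pow_left₀ hβ0.le hθ.1 2
        have h2 : θ ^ 2 ≤ 4 * β := by
          have := pow_le_pow_left₀ (hβ0.le.trans hθ.1) hθ.2 2
          nlinarith
        have h3 : ‖1 - s * φ θ‖ ≤ (1 + 4 * C) * β := by
          rw [show 1 - s * φ θ = (1 - s) + s * (1 - φ θ) by ring]
          refine (norm_add_le _ _).trans ?_
          rw [norm_mul]
          have h4 := (mul_le_of_le_one_left (norm_nonneg _) hs.le).trans (hup θ hθ')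
          nlinarith
        have h5 : 0 < ‖1 - s * φ θ‖ := norm_pos_iff.2 (h.one_sub_mul_ne_zero hs hθ')
        rw [hre_eq]
        calc c / ((1 + 4 * C) ^ 2 * β) = c * β / ((1 + 4 * C) * β) ^ 2 := by field_simp
          _ ≤ _ := by
            have h6 : c * β ≤ (1 - s * φ θ).re :=
              (mul_le_mul_of_nonneg_left h1 hc.le).trans (hre θ hθ')
            have h7 : 0 ≤ (1 - s * φ θ).re := le_trans (by positivity) h6
            gcongr
    _ ≤ ∫ θ in (-π)..π, (φ θ ^ 0 / (1 - s * φ θ) ^ (0 + 1)).re := by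
        refine intervalIntegral.integral_mono_interval (by linarith) (by linarith) hβpi ?_ hii'
        refine (ae_restrict_iff' measurableSet_Ioc).2 (.of_forall fun θ hθ => ?_)
        simp only [hre_eq, Pi.zero_apply]
        exact div_nonneg (le_trans (by positivity) (hre θ (Set.Ioc_subset_Icc_self hθ)))
          (sq_nonneg _)
    _ ≤ _ := hcomm ▸ Complex.re_le_norm _

lemma latticeIntegral_zero_ne_zero (h : IsAperiodicSymbol φ b) {s : ℂ} (hs : ‖s‖ < 1) :
    latticeIntegral φ 0 s ≠ 0 := by
  obtain ⟨c, hc, hlow⟩ := h.exists_le_norm_latticeIntegral_zero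
  have hβ : 0 < ‖1 - s‖ := norm_pos_iff.2 (sub_ne_zero.2 (by rintro rfl; simp at hs))
  exact norm_pos_iff.1 (lt_of_lt_of_le (by positivity) (hlow s hs))

end IsAperiodicSymbol

end Lattice

/-! ### Scaling limit of the period integrals -/

section Limit

open Real Topology

/-- The integral of `1 / (a + b y ^ 2) ^ (k + 1)` over the line. -/
noncomputable def resolventIntegral (b : ℝ) (k : ℕ) (a : ℂ) : ℂ :=
  ∫ y : ℝ, 1 / (a + (b : ℂ) * (y : ℂ) ^ 2) ^ (k + 1)

namespace IsAperiodicSymbol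

variable {φ : ℝ → ℂ} {b : ℝ}

lemma tendsto_mul_one_sub (h : IsAperiodicSymbol φ b) (y : ℝ) :
    Tendsto (fun n : ℕ => (n : ℂ) * (1 - φ (y / √n))) atTop (𝓝 ((b : ℂ) * (y : ℂ) ^ 2)) := by
  have hlim : Tendsto (fun n : ℕ => y / √(n : ℝ)) atTop (𝓝 0) :=
    (tendsto_sqrt_atTop.comp tendsto_natCast_atTop_atTop).const_div_atTop y
  have h1 := h.taylor.comp_tendsto hlim
  have h2 : (fun n : ℕ => (φ (y / √n) - (1 - (b : ℂ) * ((y / √n : ℝ) : ℂ) ^ 2)))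
      =o[atTop] fun n : ℕ => ((n : ℝ))⁻¹ := by
    refine h1.trans_isBigO (IsBigO.of_bound (y ^ 2) (.of_forall fun n => ?_))
    simp only [Function.comp_apply]
    rw [div_pow, Real.sq_sqrt (Nat.cast_nonneg n), div_eq_mul_inv, norm_mul,
      Real.norm_of_nonneg (sq_nonneg y)]
  have h3 : Tendsto (fun n : ℕ => (n : ℂ) * (φ (y / √n) - (1 - (b : ℂ) * ((y / √n : ℝ) : ℂ) ^ 2)))
      atTop (𝓝 0) := by
    have h4 := h2.norm_left.tendsto_div_nhds_zero
    refine tendsto_zero_iff_norm_tendsto_zero.2 (h4.congr fun n => ?_)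
    rw [div_inv_eq_mul, norm_mul, Complex.norm_natCast, mul_comm]
  have h5 := h3.const_sub ((b : ℂ) * (y : ℂ) ^ 2)
  rw [sub_zero] at h5
  refine h5.congr' ?_
  filter_upwards [eventually_gt_atTop 0] with n hn
  have hn' : (n : ℂ) ≠ 0 := by exact_mod_cast hn.ne'
  have h6 : ((y / √n : ℝ) : ℂ) ^ 2 = (y : ℂ) ^ 2 / n := by
    rw [← Complex.ofReal_pow, div_pow, Real.sq_sqrt (Nat.cast_nonneg n)]
    push_cast; ring
  rw [h6]
  field_simp
  ring

/-- Substitute `θ = y / √n`. Then `n (1 - s n * φ (y / √n))` tends to `a + b y ^ 2`, and the basic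
lower bound supplies the majorant. The `k + 1` denominators contribute `n ^ (k + 1)` and the
substitution `n ^ (-1/2)`, whence the power `2 k + 1` of `√n`. -/
lemma tendsto_latticeIntegral (h : IsAperiodicSymbol φ b) (k : ℕ) {s : ℕ → ℂ} {a : ℂ}
    (ha : 0 < a.re) (hs : ∀ᶠ n in atTop, ‖s n‖ < 1)
    (hsa : Tendsto (fun n : ℕ => (n : ℂ) * (1 - s n)) atTop (𝓝 a)) :
    Tendsto (fun n : ℕ => latticeIntegral φ k (s n) / ((√n : ℝ) : ℂ) ^ (2 * k + 1)) atTop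
      (𝓝 (resolventIntegral b k a)) := by
  have hpi := Real.pi_pos
  have hb := h.pos
  obtain ⟨κ, hκ, hlow⟩ := h.exists_le_norm_one_sub_mul
  have ha0 : 0 < ‖a‖ := norm_pos_iff.2 (by rintro rfl; simp at ha)
  set δ := ‖a‖ / 2 with hδ
  have hδ0 : 0 < δ := by positivity
  have hs1 : Tendsto s atTop (𝓝 1) := by
    have h1 : Tendsto (fun n : ℕ => ((n : ℂ))⁻¹) atTop (𝓝 0) := tendsto_inv_atTop_nhds_zero_nat
    have h2 := (h1.mul hsa).const_sub 1
    rw [zero_mul, sub_zero] at h2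
    refine h2.congr' ?_
    filter_upwards [eventually_gt_atTop 0] with n hn
    have hn' : (n : ℂ) ≠ 0 := by exact_mod_cast hn.ne'
    field_simp
    ring
  -- Extension by zero turns the growing intervals into one integral over the line.
  let f : ℕ → ℝ → ℂ := fun n =>
    (Set.Ioc (-π) π).indicator fun θ => φ θ ^ k / (1 - s n * φ θ) ^ (k + 1)
  have hrw : ∀ n : ℕ, 0 < n → latticeIntegral φ k (s n) / ((√n : ℝ) : ℂ) ^ (2 * k + 1)
      = ∫ y : ℝ, f n (y / √n) / (n : ℂ) ^ (k + 1) := fun n hn => by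
    have hn' : (0 : ℝ) < n := by exact_mod_cast hn
    have hsq : ((√n : ℝ) : ℂ) ^ 2 = n := by
      rw [← Complex.ofReal_pow, Real.sq_sqrt hn'.le, Complex.ofReal_natCast]
    have hne : ((√n : ℝ) : ℂ) ≠ 0 := by
      simpa using (Real.sqrt_pos.2 hn').ne'
    rw [integral_div, Measure.integral_comp_div (f n), abs_of_nonneg (Real.sqrt_nonneg _),
      latticeIntegral, intervalIntegral.integral_of_le (by linarith),
      ← integral_indicator measurableSet_Ioc, Complex.real_smul, ← hsq]
    field_simp
    ring
  refine Tendsto.congr' (f₁ := fun n : ℕ => ∫ y : ℝ, f n (y / √n) / (n : ℂ) ^ (k + 1)) ?_ ?_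
  · filter_upwards [eventually_gt_atTop 0] with n hn using (hrw n hn).symm
  refine tendsto_integral_filter_of_dominated_convergence
    (fun y => (κ ^ (k + 1) * δ ^ k)⁻¹ * (δ + 1 * y ^ 2)⁻¹) ?_ ?_
    ((integrable_inv_add_mul_sq hδ0 one_pos).const_mul _) ?_
  · refine .of_forall fun n => Measurable.aestronglyMeasurable ?_
    have := h.continuous.measurable
    have h1 : Measurable (f n) := Measurable.indicator (by fun_prop) measurableSet_Ioc
    fun_prop
  · have h1 : ∀ᶠ n : ℕ in atTop, δ < ‖(n : ℂ) * (1 - s n)‖ :=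
      hsa.norm.eventually (lt_mem_nhds (by rw [hδ]; linarith))
    filter_upwards [h1, hs, eventually_gt_atTop 0] with n hn hsn hn0
    refine .of_forall fun y => ?_
    have hn' : (0 : ℝ) < n := by exact_mod_cast hn0
    by_cases hy : y / √n ∈ Set.Ioc (-π) π
    · simp only [f, Set.indicator_of_mem hy]
      have hy' := Set.Ioc_subset_Icc_self hy
      have h2 := hlow (s n) hsn.le _ hy'
      rw [norm_mul, Complex.norm_natCast] at hn
      rw [norm_div, norm_div, norm_pow, norm_pow, norm_pow, Complex.norm_natCast, ← mul_inv,
        ← one_div, div_div]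
      have h3 : κ * (δ + y ^ 2) ≤ ‖1 - s n * φ (y / √n)‖ * n := by
        calc κ * (δ + y ^ 2) ≤ κ * (n * ‖1 - s n‖ + y ^ 2) := by gcongr
          _ = κ * (‖1 - s n‖ + (y / √n) ^ 2) * n := by
            rw [div_pow, Real.sq_sqrt hn'.le]; field_simp
          _ ≤ _ := by gcongr
      refine div_le_div₀ zero_le_one (pow_le_one₀ (norm_nonneg _) (h.norm_le hy'))
        (by positivity) ?_
      · calc κ ^ (k + 1) * δ ^ k * (δ + 1 * y ^ 2)
            ≤ κ ^ (k + 1) * (δ + y ^ 2) ^ k * (δ + y ^ 2) := by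
              rw [one_mul]; gcongr; nlinarith
          _ = (κ * (δ + y ^ 2)) ^ (k + 1) := by rw [mul_pow]; ring
          _ ≤ (‖1 - s n * φ (y / √n)‖ * n) ^ (k + 1) := by gcongr
          _ = _ := mul_pow _ _ _
    · simp only [f, Set.indicator_of_notMem hy, zero_div, norm_zero]
      positivity
  · refine .of_forall fun y => ?_
    have hlim : Tendsto (fun n : ℕ => y / √(n : ℝ)) atTop (𝓝 0) :=
      (tendsto_sqrt_atTop.comp tendsto_natCast_atTop_atTop).const_div_atTop y
    have hφ : Tendsto (fun n : ℕ => φ (y / √n)) atTop (𝓝 1) := by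
      rw [← h.map_zero]
      exact (h.continuous.tendsto 0).comp hlim
    have h1 : Tendsto (fun n : ℕ => (n : ℂ) * (1 - s n * φ (y / √n))) atTop
        (𝓝 (a + (b : ℂ) * (y : ℂ) ^ 2)) := by
      have h2 := hsa.add (hs1.mul (h.tendsto_mul_one_sub y))
      rw [one_mul] at h2
      refine h2.congr fun n => by ring
    have hne : a + (b : ℂ) * (y : ℂ) ^ 2 ≠ 0 := by
      intro h0
      have h1 := congrArg Complex.re h0
      rw [← Complex.ofReal_pow, ← Complex.ofReal_mul, Complex.add_re, Complex.ofReal_re,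
        Complex.zero_re] at h1
      nlinarith [mul_nonneg hb.le (sq_nonneg y)]
    have h3 := (hφ.pow k).div (h1.pow (k + 1)) (pow_ne_zero _ hne)
    rw [one_pow] at h3
    refine h3.congr' ?_
    have hmem : ∀ᶠ n : ℕ in atTop, y / √n ∈ Set.Ioc (-π) π :=
      hlim.eventually (Ioc_mem_nhds (by linarith) hpi)
    filter_upwards [hmem] with n hn
    simp only [f, Set.indicator_of_mem hn]
    rw [Pi.div_apply, mul_pow, div_div, mul_comm (_ ^ (k + 1))]

end IsAperiodicSymbol

end Limit

/-! ### Closed forms of the limit integrals on the right half-plane -/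

section HalfPlane

open Real Topology

lemma isOpen_re_pos : IsOpen {z : ℂ | 0 < z.re} := isOpen_lt continuous_const Complex.continuous_re

/-- Two holomorphic functions on the right half-plane which agree on the positive reals agree. -/
lemma eqOn_re_pos_of_eq_ofReal {f g : ℂ → ℂ} (hf : DifferentiableOn ℂ f {z | 0 < z.re})
    (hg : DifferentiableOn ℂ g {z | 0 < z.re}) (h : ∀ x : ℝ, 0 < x → f x = g x) :
    Set.EqOn f g {z | 0 < z.re} := by
  refine (hf.analyticOnNhd isOpen_re_pos).eqOn_of_preconnected_of_frequently_eq
    (hg.analyticOnNhd isOpen_re_pos) (convex_halfSpace_re_gt 0).isPreconnected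
    (z₀ := ((1 : ℝ) : ℂ)) (by simp) ?_
  have h1 : Tendsto (fun x : ℝ => (x : ℂ)) (𝓝[≠] 1) (𝓝[≠] ((1 : ℝ) : ℂ)) :=
    Complex.continuous_ofReal.continuousAt.continuousWithinAt.tendsto_nhdsWithin
      fun x hx => by simpa using hx
  refine h1.frequently (Eventually.frequently ?_)
  filter_upwards [mem_nhdsWithin_of_mem_nhds (lt_mem_nhds one_pos)] with x hx using h x hx

lemma half_re_lt_mem_nhds {a : ℂ} (ha : 0 < a.re) : {z : ℂ | a.re / 2 < z.re} ∈ 𝓝 a :=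
  (isOpen_lt continuous_const Complex.continuous_re).mem_nhds
    (show a.re / 2 < a.re by linarith)

lemma re_le_norm_add_mul_sq {b : ℝ} (a : ℂ) (y : ℝ) :
    a.re + b * y ^ 2 ≤ ‖a + (b : ℂ) * (y : ℂ) ^ 2‖ := by
  refine le_trans (le_of_eq ?_) (Complex.re_le_norm _)
  rw [← Complex.ofReal_pow, ← Complex.ofReal_mul, Complex.add_re, Complex.ofReal_re]

lemma norm_resolvent_integrand_le {b : ℝ} (hb : 0 < b) (k : ℕ) {a : ℂ} {ε : ℝ} (hε : 0 < ε)
    (ha : ε ≤ a.re) (y : ℝ) :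
    ‖1 / (a + (b : ℂ) * (y : ℂ) ^ 2) ^ (k + 1)‖ ≤ (ε ^ k)⁻¹ * (ε + b * y ^ 2)⁻¹ := by
  have h1 := re_le_norm_add_mul_sq (b := b) a y
  have h2 : 0 ≤ b * y ^ 2 := by positivity
  rw [norm_div, norm_one, norm_pow, ← mul_inv, ← one_div]
  refine one_div_le_one_div_of_le (by positivity) ?_
  calc ε ^ k * (ε + b * y ^ 2) ≤ (ε + b * y ^ 2) ^ k * (ε + b * y ^ 2) := by
        gcongr; linarith
    _ = (ε + b * y ^ 2) ^ (k + 1) := by ring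
    _ ≤ _ := by gcongr; linarith

lemma add_mul_sq_ne_zero {b : ℝ} (hb : 0 < b) {a : ℂ} (ha : 0 < a.re) (y : ℝ) :
    a + (b : ℂ) * (y : ℂ) ^ 2 ≠ 0 :=
  norm_pos_iff.1 (lt_of_lt_of_le (by positivity) (re_le_norm_add_mul_sq a y))

lemma aestronglyMeasurable_resolvent_integrand (b : ℝ) (k : ℕ) (a : ℂ) :
    AEStronglyMeasurable (fun y : ℝ => 1 / (a + (b : ℂ) * (y : ℂ) ^ 2) ^ (k + 1)) volume :=
  Measurable.aestronglyMeasurable (by fun_prop)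

lemma hasDerivAt_resolventIntegral {b : ℝ} (hb : 0 < b) (k : ℕ) {a : ℂ} (ha : 0 < a.re) :
    HasDerivAt (resolventIntegral b k) (-((k + 1) * resolventIntegral b (k + 1) a)) a := by
  have hε : 0 < a.re / 2 := by linarith
  have key := hasDerivAt_integral_of_dominated_loc_of_deriv_le (μ := volume)
    (F := fun (a : ℂ) (y : ℝ) => 1 / (a + (b : ℂ) * (y : ℂ) ^ 2) ^ (k + 1))
    (F' := fun (a : ℂ) (y : ℝ) => (-(k + 1 : ℂ)) * (1 / (a + (b : ℂ) * (y : ℂ) ^ 2) ^ (k + 1 + 1)))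
    (bound := fun y => ‖-(k + 1 : ℂ)‖ * (((a.re / 2) ^ (k + 1))⁻¹ * (a.re / 2 + b * y ^ 2)⁻¹))
    (half_re_lt_mem_nhds ha) (.of_forall fun z => aestronglyMeasurable_resolvent_integrand b k z)
    ?_ ((aestronglyMeasurable_resolvent_integrand b (k + 1) a).const_mul _) ?_
    (((integrable_inv_add_mul_sq hε hb).const_mul _).const_mul _) ?_
  · have := key.2
    rw [integral_const_mul] at this
    rw [← neg_mul]
    exact this
  · exact Integrable.mono' ((integrable_inv_add_mul_sq ha hb).const_mul _)
      (aestronglyMeasurable_resolvent_integrand b k a)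
      (.of_forall fun y => norm_resolvent_integrand_le hb k ha le_rfl y)
  · refine .of_forall fun y z hz => ?_
    rw [norm_mul]
    gcongr
    exact norm_resolvent_integrand_le hb (k + 1) hε (le_of_lt hz) y
  · refine .of_forall fun y z hz => ?_
    have hne := add_mul_sq_ne_zero hb (hε.trans hz) y
    have h2 := (((hasDerivAt_id z).add_const ((b : ℂ) * (y : ℂ) ^ 2)).pow (k + 1)).inv
      (pow_ne_zero _ hne)
    simp_rw [one_div]
    convert! h2 using 1
    push_cast
    simp only [Pi.pow_apply, id]
    field_simp
    ring

lemma hasDerivAt_cpow_of_re_pos {a : ℂ} (ha : 0 < a.re) (c : ℂ) :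
    HasDerivAt (fun z : ℂ => z ^ c) (c * a ^ (c - 1)) a := by
  simpa using (hasDerivAt_id a).cpow_const (c := c) (Or.inl ha)

/-- For positive real `a` this is the arctangent integral; the identity theorem extends it to the
half-plane. -/
lemma resolventIntegral_zero {b : ℝ} (hb : 0 < b) {a : ℂ} (ha : 0 < a.re) :
    resolventIntegral b 0 a = (π / √b : ℝ) * a ^ (-(1 / 2) : ℂ) := by
  refine eqOn_re_pos_of_eq_ofReal (g := fun a => (π / √b : ℝ) * a ^ (-(1 / 2) : ℂ))
    (fun z hz => (hasDerivAt_resolventIntegral hb 0 hz).differentiableAt.differentiableWithinAt)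
    (fun z hz => ((hasDerivAt_cpow_of_re_pos hz _).const_mul _).differentiableAt.differentiableWithinAt)
    (fun x hx => ?_) ha
  have h1 : ∀ y : ℝ, 1 / ((x : ℂ) + (b : ℂ) * (y : ℂ) ^ 2) ^ (0 + 1)
      = (((x + b * y ^ 2)⁻¹ : ℝ) : ℂ) := fun y => by push_cast; ring
  simp only [resolventIntegral]
  simp_rw [h1]
  rw [integral_complex_ofReal, integral_inv_add_mul_sq hx hb,
    show (-(1 / 2) : ℂ) = ((-(1 / 2) : ℝ) : ℂ) by push_cast; ring, ← Complex.ofReal_cpow hx.le,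
    ← Complex.ofReal_mul, Real.rpow_neg hx.le, ← Real.sqrt_eq_rpow]
  congr 1
  field_simp

/-- Obtained by differentiating the formula for `k = 0`; the case `k = 2` follows from this one in
the same way. -/
lemma resolventIntegral_one {b : ℝ} (hb : 0 < b) {a : ℂ} (ha : 0 < a.re) :
    resolventIntegral b 1 a = (π / √b : ℝ) * (1 / 2) * a ^ (-(3 / 2) : ℂ) := by
  have h1 := hasDerivAt_resolventIntegral hb 0 ha
  have h2 := (hasDerivAt_cpow_of_re_pos ha (-(1 / 2))).const_mul ((π / √b : ℝ) : ℂ)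
  have h3 : resolventIntegral b 0 =ᶠ[𝓝 a] fun z => (π / √b : ℝ) * z ^ (-(1 / 2) : ℂ) := by
    filter_upwards [isOpen_re_pos.mem_nhds ha] with z hz using resolventIntegral_zero hb hz
  have h4 := h1.unique (h2.congr_of_eventuallyEq h3)
  rw [show (-(1 / 2) - 1 : ℂ) = -(3 / 2) by norm_num] at h4
  simp only [Nat.cast_zero, zero_add, one_mul] at h4
  linear_combination -h4

lemma resolventIntegral_two {b : ℝ} (hb : 0 < b) {a : ℂ} (ha : 0 < a.re) :
    resolventIntegral b 2 a = (π / √b : ℝ) * (3 / 8) * a ^ (-(5 / 2) : ℂ) := by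
  have h1 := hasDerivAt_resolventIntegral hb 1 ha
  have h2 := (hasDerivAt_cpow_of_re_pos ha (-(3 / 2))).const_mul (((π / √b : ℝ) : ℂ) * (1 / 2))
  have h3 : resolventIntegral b 1 =ᶠ[𝓝 a]
      fun z => (π / √b : ℝ) * (1 / 2) * z ^ (-(3 / 2) : ℂ) := by
    filter_upwards [isOpen_re_pos.mem_nhds ha] with z hz using resolventIntegral_one hb hz
  have h4 := h1.unique (h2.congr_of_eventuallyEq h3)
  rw [show (-(3 / 2) - 1 : ℂ) = -(5 / 2) by norm_num] at h4
  norm_num at h4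
  push_cast
  linear_combination (1 / 2) * h4

/-- This is the expression defining `A''` with each period integral replaced by its limit. In terms
of `w = a ^ (-1/2)` both quotients are multiples of `w ^ 3`, and `2 * (3/8) - 2 * (1/2) ^ 2 = 1/4`
is the surviving coefficient. -/
lemma resolventIntegral_combination {b : ℝ} (hb : 0 < b) {a : ℂ} (ha : 0 < a.re) :
    2 * π * (2 * resolventIntegral b 2 a / resolventIntegral b 0 a ^ 2
      - 2 * resolventIntegral b 1 a ^ 2 / resolventIntegral b 0 a ^ 3)
      = (√b / 2 : ℝ) * a ^ (-(3 / 2) : ℂ) := by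
  have ha0 : a ≠ 0 := by rintro rfl; simp at ha
  rw [resolventIntegral_zero hb ha, resolventIntegral_one hb ha, resolventIntegral_two hb ha]
  set w := a ^ (-(1 / 2) : ℂ) with hw
  have hw0 : w ≠ 0 := by rw [hw, Ne, Complex.cpow_eq_zero_iff]; tauto
  have h3 : a ^ (-(3 / 2) : ℂ) = w ^ 3 := by
    rw [hw, ← Complex.cpow_mul_nat]; norm_num
  have h5 : a ^ (-(5 / 2) : ℂ) = w ^ 5 := by
    rw [hw, ← Complex.cpow_mul_nat]; norm_num
  have hb0 : ((√b : ℝ) : ℂ) ≠ 0 := by simpa using (Real.sqrt_pos.2 hb).ne'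
  have hpi : (π : ℂ) ≠ 0 := by simp
  rw [h3, h5]
  push_cast
  field_simp
  ring

end HalfPlane

/-! ### Laplace transform of the square root and the limiting oscillatory integral -/

section Gamma

open Real Topology FourierTransform

lemma integrable_sqrt_pow_mul_exp (m : ℕ) {c : ℝ} (hc : 0 < c) :
    Integrable fun v : ℝ => v ^ m * √v * rexp (-c * v) := by
  have h1 : IntegrableOn (fun v : ℝ => v ^ m * √v * rexp (-c * v)) (Set.Ioi 0) := by
    refine (integrableOn_rpow_mul_exp_neg_mul_rpow (p := 1) (s := m + 1 / 2) (b := c)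
      (by have : (0 : ℝ) ≤ m := m.cast_nonneg
          linarith) one_pos hc).congr_fun (fun v hv => ?_) measurableSet_Ioi
    have hv' : 0 < v := hv
    simp only [Real.rpow_one]
    rw [Real.rpow_add hv', Real.rpow_natCast, ← Real.sqrt_eq_rpow]
  -- `√v` is `0` for `v ≤ 0`, so integrals over the line are really over the half-line.
  have h2 : IntegrableOn (fun v : ℝ => v ^ m * √v * rexp (-c * v)) (Set.Iic 0) :=
    (integrableOn_zero (s := Set.Iic (0 : ℝ))).congr_fun
      (fun v hv => by simp [Real.sqrt_eq_zero_of_nonpos hv]) measurableSet_Iic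
  rw [← integrableOn_univ, ← Set.Iic_union_Ioi (a := (0 : ℝ))]
  exact h2.union h1

/-- The Laplace transform of the square root. -/
lemma integral_sqrt_mul_cexp {a : ℂ} (ha : 0 < a.re) :
    ∫ v : ℝ, (√v : ℂ) * Complex.exp (-(a * v)) = Real.Gamma (3 / 2) * a ^ (-(3 / 2) : ℂ) := by
  have hmeas : ∀ (m : ℕ) (a : ℂ), AEStronglyMeasurable
      (fun v : ℝ => (v : ℂ) ^ m * (√v : ℂ) * Complex.exp (-(a * v))) volume := fun m a =>
    Continuous.aestronglyMeasurable (by fun_prop)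
  have hnorm : ∀ (m : ℕ) (a : ℂ) (v : ℝ),
      ‖(v : ℂ) ^ m * (√v : ℂ) * Complex.exp (-(a * v))‖ = |v| ^ m * √v * rexp (-a.re * v) := by
    intro m a v
    rw [norm_mul, norm_mul, norm_pow, Complex.norm_real, Complex.norm_real, Complex.norm_exp,
      Real.norm_of_nonneg (Real.sqrt_nonneg v), Real.norm_eq_abs]
    simp
  have hbound : ∀ (m : ℕ) {a : ℂ} {c : ℝ}, c ≤ a.re → ∀ v : ℝ,
      ‖(v : ℂ) ^ m * (√v : ℂ) * Complex.exp (-(a * v))‖ ≤ v ^ m * √v * rexp (-c * v) := by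
    intro m a c hc v
    rw [hnorm]
    rcases le_or_gt v 0 with hv | hv
    · simp [Real.sqrt_eq_zero_of_nonpos hv]
    · rw [abs_of_pos hv]
      gcongr
  have hderiv : ∀ a : ℂ, 0 < a.re → HasDerivAt
      (fun a : ℂ => ∫ v : ℝ, (√v : ℂ) * Complex.exp (-(a * v)))
      (∫ v : ℝ, -((v : ℂ) ^ 1 * (√v : ℂ) * Complex.exp (-(a * v)))) a := by
    intro a ha
    have hε : 0 < a.re / 2 := by linarith
    refine (hasDerivAt_integral_of_dominated_loc_of_deriv_le (μ := volume)
      (F := fun (a : ℂ) (v : ℝ) => (√v : ℂ) * Complex.exp (-(a * v)))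
      (F' := fun (a : ℂ) (v : ℝ) => -((v : ℂ) ^ 1 * (√v : ℂ) * Complex.exp (-(a * v))))
      (bound := fun v => v ^ 1 * √v * rexp (-(a.re / 2) * v))
      (half_re_lt_mem_nhds ha) (.of_forall fun z => ?_) ?_ (hmeas 1 a).neg ?_
      (integrable_sqrt_pow_mul_exp 1 hε) ?_).2
    · simpa using hmeas 0 z
    · have := Integrable.mono' (integrable_sqrt_pow_mul_exp 0 ha) (hmeas 0 a)
        (.of_forall (hbound 0 le_rfl))
      simpa using this
    · refine .of_forall fun v z hz => ?_
      rw [norm_neg]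
      exact hbound 1 (le_of_lt hz) v
    · refine .of_forall fun v z hz => ?_
      have h1 : HasDerivAt (fun z : ℂ => -(z * v)) (-v : ℂ) z := by
        simpa using ((hasDerivAt_id z).mul_const (v : ℂ)).fun_neg
      convert! h1.cexp.const_mul (√v : ℂ) using 1
      ring
  -- Both sides are holomorphic, so it suffices to treat real `a`, where this is the Gamma integral.
  refine eqOn_re_pos_of_eq_ofReal (f := fun a => ∫ v : ℝ, (√v : ℂ) * Complex.exp (-(a * v)))
    (g := fun a => Real.Gamma (3 / 2) * a ^ (-(3 / 2) : ℂ))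
    (fun z hz => (hderiv z hz).differentiableAt.differentiableWithinAt)
    (fun z hz => ((hasDerivAt_cpow_of_re_pos hz _).const_mul _).differentiableAt.differentiableWithinAt)
    (fun x hx => ?_) ha
  have h1 : ∀ v : ℝ, (√v : ℂ) * Complex.exp (-((x : ℂ) * v))
      = ((√v * rexp (-(x * v)) : ℝ) : ℂ) := fun v => by push_cast; ring
  simp_rw [h1]
  rw [integral_complex_ofReal, ← setIntegral_eq_integral_of_forall_compl_eq_zero (s := Set.Ioi 0)
    fun v hv => by rw [Real.sqrt_eq_zero_of_nonpos (not_lt.1 hv), zero_mul]]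
  have h2 := Real.integral_rpow_mul_exp_neg_mul_Ioi (a := 3 / 2) (by norm_num) hx
  rw [show (3 / 2 - 1 : ℝ) = 1 / 2 by norm_num] at h2
  simp_rw [Real.sqrt_eq_rpow]
  rw [h2, show (-(3 / 2) : ℂ) = ((-(3 / 2) : ℝ) : ℂ) by push_cast; ring, ← Complex.ofReal_cpow hx.le,
    ← Complex.ofReal_mul, Real.rpow_neg hx.le, one_div, Real.inv_rpow hx.le, mul_comm]

lemma one_sub_mul_I_re (x : ℝ) : (1 - (x : ℂ) * Complex.I).re = 1 := by simp

lemma norm_one_sub_mul_I (x : ℝ) : ‖1 - (x : ℂ) * Complex.I‖ = √(1 + x ^ 2) := by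
  rw [show 1 - (x : ℂ) * Complex.I = ((1 : ℝ) : ℂ) + ((-x : ℝ) : ℂ) * Complex.I by push_cast; ring,
    Complex.norm_add_mul_I]
  congr 1
  ring

lemma integrable_one_add_sq_rpow : Integrable fun x : ℝ => (1 + x ^ 2) ^ (-(3 / 4) : ℝ) := by
  have := integrable_rpow_neg_one_add_norm_sq (E := ℝ) (μ := volume) (r := 3 / 2) (by norm_num)
  refine this.congr (.of_forall fun x => ?_)
  simp only [Real.norm_eq_abs, sq_abs]
  norm_num

/-- Up to the factor `Γ(3/2) = √π / 2` and a rescaling of frequency, `(1 - i x) ^ (-3/2)` is the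
Fourier transform of `√v e ^ (-v)`. Inversion at `v = 1` gives `2 π e⁻¹ / Γ(3/2)`. -/
lemma integral_one_sub_mul_I_cpow_mul_cexp :
    ∫ x : ℝ, (1 - (x : ℂ) * Complex.I) ^ (-(3 / 2) : ℂ) * Complex.exp (-(x * Complex.I))
      = (4 * √π * rexp (-1) : ℝ) := by
  set f : ℝ → ℂ := fun v => (√v : ℂ) * Complex.exp (-((1 : ℂ) * v)) with hf
  have hfc : Continuous f := by fun_prop
  have hfi : Integrable f := by
    refine Integrable.mono' (integrable_sqrt_pow_mul_exp 0 one_pos) hfc.aestronglyMeasurable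
      (.of_forall fun v => le_of_eq ?_)
    rw [norm_mul, Complex.norm_real, Complex.norm_exp, Real.norm_of_nonneg (Real.sqrt_nonneg v)]
    simp
  have hF : ∀ w : ℝ, 𝓕 f w
      = Real.Gamma (3 / 2) * (1 - ((-(2 * π)) * w : ℝ) * Complex.I) ^ (-(3 / 2) : ℂ) := fun w => by
    rw [Real.fourier_real_eq_integral_exp_smul,
      ← integral_sqrt_mul_cexp (by rw [one_sub_mul_I_re]; exact one_pos)]
    refine integral_congr_ae (.of_forall fun v => ?_)
    simp only [f, smul_eq_mul]
    rw [mul_left_comm, ← Complex.exp_add]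
    congr 2
    push_cast
    ring
  have hmeas : Continuous fun x : ℝ => (1 - (x : ℂ) * Complex.I) ^ (-(3 / 2) : ℂ) := by
    refine Continuous.cpow (by fun_prop) continuous_const fun x => Or.inl ?_
    rw [one_sub_mul_I_re]
    exact one_pos
  have hgi : Integrable fun x : ℝ => (1 - (x : ℂ) * Complex.I) ^ (-(3 / 2) : ℂ) := by
    refine Integrable.mono' integrable_one_add_sq_rpow hmeas.aestronglyMeasurable
      (.of_forall fun x => le_of_eq ?_)
    rw [show (-(3 / 2) : ℂ) = ((-(3 / 2) : ℝ) : ℂ) by push_cast; ring, Complex.norm_cpow_real,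
      norm_one_sub_mul_I, Real.sqrt_eq_rpow, ← Real.rpow_mul (by positivity)]
    norm_num
  have hpi : -(2 * π) ≠ 0 := by have := Real.pi_pos; linarith
  have hFi : Integrable (𝓕 f) := by
    rw [show 𝓕 f = _ from funext hF]
    exact (hgi.comp_mul_left' hpi).const_mul _
  have key := hfi.fourierInv_fourier_eq hFi (v := 1) hfc.continuousAt
  rw [Real.fourierInv_eq'] at key
  set g : ℝ → ℂ := fun x =>
    (1 - (x : ℂ) * Complex.I) ^ (-(3 / 2) : ℂ) * Complex.exp (-(x * Complex.I)) with hg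
  have h1 : ∀ w : ℝ, Complex.exp (((2 * π * inner ℝ w (1 : ℝ) : ℝ) : ℂ) * Complex.I) • 𝓕 f w
      = Real.Gamma (3 / 2) * g (-(2 * π) * w) := fun w => by
    have hw : inner ℝ w (1 : ℝ) = w := by simp
    rw [hF, smul_eq_mul, hg, hw, mul_left_comm]
    congr 1
    simp only
    rw [mul_comm]
    congr 2
    push_cast
    ring
  simp_rw [h1] at key
  rw [integral_const_mul, Measure.integral_comp_mul_left g, abs_inv, abs_neg,
    abs_of_pos (by positivity)] at key
  have hG : Real.Gamma (3 / 2) = √π / 2 := by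
    rw [show (3 / 2 : ℝ) = 1 / 2 + 1 by norm_num, Real.Gamma_add_one (by norm_num),
      Real.Gamma_one_half_eq]
    ring
  have hf1 : f 1 = (rexp (-1) : ℝ) := by simp [hf]
  rw [hG, hf1, Complex.real_smul] at key
  have hs : ((√π : ℝ) : ℂ) ^ 2 = π := by
    rw [← Complex.ofReal_pow, Real.sq_sqrt Real.pi_pos.le]
  have hs0 : ((√π : ℝ) : ℂ) ≠ 0 := by simpa using (Real.sqrt_pos.2 Real.pi_pos).ne'
  push_cast at key ⊢
  rw [← key, ← hs]
  field_simp
  norm_num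

end Gamma

/-! ### Taylor coefficients as integrals over circles -/

section Coefficients

open Real Topology

lemma norm_circle_point {r : ℝ} (hr : 0 ≤ r) (t : ℝ) : ‖(r : ℂ) * Complex.exp (t * Complex.I)‖ = r := by
  rw [norm_mul, Complex.norm_exp_ofReal_mul_I, mul_one, Complex.norm_real, Real.norm_of_nonneg hr]

lemma exp_int_mul_pi_periodic (m : ℤ) :
    Complex.exp (m * (π : ℝ) * Complex.I) = Complex.exp (m * (-π : ℝ) * Complex.I) := by
  rw [Complex.exp_eq_exp_iff_exists_int]
  exact ⟨m, by push_cast; ring⟩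

lemma integral_exp_int_mul (m : ℤ) :
    ∫ t in (-π)..π, Complex.exp (m * t * Complex.I) = if m = 0 then (2 * π : ℂ) else 0 := by
  split_ifs with hm
  · subst hm
    simp
    ring
  · have hc : (m : ℂ) * Complex.I ≠ 0 := by simp [hm]
    have h1 := integral_exp_mul_complex (a := -π) (b := π) hc
    have h2 := exp_int_mul_pi_periodic m
    rw [show ∀ z : ℂ, (m : ℂ) * z * Complex.I = m * Complex.I * z from fun z => by ring,
      show (m : ℂ) * ((-π : ℝ) : ℂ) * Complex.I = m * Complex.I * ((-π : ℝ) : ℂ) by ring] at h2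
    rw [h2, sub_self, zero_div] at h1
    rw [← h1]
    congr 1 with t
    ring_nf

/-- Cauchy's coefficient formula on a circle about the origin. -/
lemma integral_circle_eq_coeff {a : ℕ → ℂ} {A : ℂ → ℂ} {C : ℝ} (ha : ∀ n, ‖a n‖ ≤ C)
    (hA : ∀ s : ℂ, ‖s‖ < 1 → HasSum (fun n => a n * s ^ n) (A s)) {r : ℝ} (hr0 : 0 ≤ r)
    (hr1 : r < 1) (n : ℕ) :
    ∫ t in (-π)..π, A (r * Complex.exp (t * Complex.I)) * Complex.exp (-(n * t * Complex.I))
      = 2 * π * r ^ n * a n := by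
  have h1 := intervalIntegral.hasSum_integral_of_dominated_convergence (μ := volume) (a := -π) (b := π)
    (F := fun (k : ℕ) (t : ℝ) => a k * (r * Complex.exp (t * Complex.I)) ^ k
      * Complex.exp (-(n * t * Complex.I)))
    (f := fun t : ℝ => A (r * Complex.exp (t * Complex.I)) * Complex.exp (-(n * t * Complex.I)))
    (fun k _ => C * r ^ k) (fun k => Continuous.aestronglyMeasurable (by fun_prop)) ?_ ?_ ?_ ?_
  · have h2 : ∀ k : ℕ, ∫ t in (-π)..π, a k * (r * Complex.exp (t * Complex.I)) ^ k
        * Complex.exp (-(n * t * Complex.I)) = if k = n then 2 * π * r ^ n * a n else 0 := by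
      intro k
      have h3 : ∀ t : ℝ, a k * (r * Complex.exp (t * Complex.I)) ^ k
          * Complex.exp (-(n * t * Complex.I))
          = a k * r ^ k * Complex.exp (((k - n : ℤ) : ℂ) * t * Complex.I) := fun t => by
        rw [mul_pow, ← Complex.exp_nat_mul, ← mul_assoc, mul_assoc _ (Complex.exp _),
          ← Complex.exp_add]
        congr 2
        push_cast
        ring
      simp_rw [h3]
      rw [intervalIntegral.integral_const_mul, integral_exp_int_mul]
      by_cases hk : k = n
      · subst hk
        simp only [sub_self, if_true]
        ring
      · rw [if_neg (by omega), if_neg hk, mul_zero]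
    simp_rw [h2] at h1
    have h4 := hasSum_ite_eq n (2 * π * r ^ n * a n)
    exact h1.unique h4
  · refine fun k => .of_forall fun t _ => ?_
    have h5 : ‖Complex.exp (-(n * t * Complex.I))‖ = 1 := by
      rw [Complex.norm_exp]; simp
    rw [norm_mul, norm_mul, norm_pow, norm_circle_point hr0, h5, mul_one]
    gcongr
    exact ha k
  · exact .of_forall fun t _ => (summable_geometric_of_lt_one hr0 hr1).mul_left C
  · exact intervalIntegrable_const
  · refine .of_forall fun t _ => (hA _ ?_).mul_right _
    rwa [norm_circle_point hr0]

/-- Integration by parts on a circle about the origin. -/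
lemma int_mul_integral_circle {g g' : ℂ → ℂ} (hg : ∀ s : ℂ, ‖s‖ < 1 → HasDerivAt g (g' s) s)
    (hg' : ContinuousOn g' {s | ‖s‖ < 1}) {r : ℝ} (hr0 : 0 ≤ r) (hr1 : r < 1) (m : ℤ) :
    m * ∫ t in (-π)..π, g (r * Complex.exp (t * Complex.I)) * Complex.exp (-(m * t * Complex.I))
      = ∫ t in (-π)..π, (r * Complex.exp (t * Complex.I)) * g' (r * Complex.exp (t * Complex.I))
        * Complex.exp (-(m * t * Complex.I)) := by
  have hmem : ∀ t : ℝ, ‖(r : ℂ) * Complex.exp (t * Complex.I)‖ < 1 := fun t => by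
    rwa [norm_circle_point hr0]
  have hcont : Continuous fun t : ℝ => (r : ℂ) * Complex.exp (t * Complex.I) := by fun_prop
  have hgc : Continuous fun t : ℝ => g (r * Complex.exp (t * Complex.I)) :=
    continuous_iff_continuousAt.2 fun t =>
      ContinuousAt.comp (g := g) (hg _ (hmem t)).continuousAt hcont.continuousAt
  have hgc' : Continuous fun t : ℝ => g' (r * Complex.exp (t * Complex.I)) :=
    hg'.comp_continuous hcont hmem
  have hderiv : ∀ t ∈ Set.uIcc (-π) π, HasDerivAt
      (fun t : ℝ => g (r * Complex.exp (t * Complex.I)) * Complex.exp (-(m * t * Complex.I)))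
      (Complex.I * ((r * Complex.exp (t * Complex.I)) * g' (r * Complex.exp (t * Complex.I))
        * Complex.exp (-(m * t * Complex.I)))
        - Complex.I * (m * (g (r * Complex.exp (t * Complex.I))
          * Complex.exp (-(m * t * Complex.I))))) t := by
    intro t _
    have h0 : HasDerivAt (fun t : ℝ => (t : ℂ)) 1 t := Complex.ofRealCLM.hasDerivAt
    have h1 : HasDerivAt (fun t : ℝ => (r : ℂ) * Complex.exp (t * Complex.I))
        (r * (Complex.exp (t * Complex.I) * (1 * Complex.I))) t :=
      ((h0.mul_const Complex.I).cexp).const_mul (r : ℂ)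
    have h2 := HasDerivAt.comp (h₂ := g) t (hg _ (hmem t)) h1
    have h3 : HasDerivAt (fun t : ℝ => Complex.exp (-(m * t * Complex.I)))
        (Complex.exp (-(m * t * Complex.I)) * -(m * 1 * Complex.I)) t :=
      (((h0.const_mul (m : ℂ)).mul_const Complex.I).fun_neg).cexp
    convert! h2.mul h3 using 1
    simp only [Function.comp_apply]
    ring
  have hi1 : Continuous fun t : ℝ => (r * Complex.exp (t * Complex.I))
      * g' (r * Complex.exp (t * Complex.I)) * Complex.exp (-(m * t * Complex.I)) :=
    (hcont.mul hgc').mul (by fun_prop)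
  have hi2 : Continuous fun t : ℝ => g (r * Complex.exp (t * Complex.I))
      * Complex.exp (-(m * t * Complex.I)) := hgc.mul (by fun_prop)
  have key := intervalIntegral.integral_eq_sub_of_hasDerivAt hderiv
    (Continuous.intervalIntegrable (by fun_prop) _ _)
  rw [intervalIntegral.integral_sub ((hi1.const_mul _).intervalIntegrable _ _)
    (((hi2.const_mul _).const_mul _).intervalIntegrable _ _),
    intervalIntegral.integral_const_mul, intervalIntegral.integral_const_mul,
    intervalIntegral.integral_const_mul] at key
  -- The frequency is an integer, so the differentiated function agrees at `-π` and `π` and the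
  -- boundary term vanishes.
  have h1 := exp_int_mul_pi_periodic 1
  have h2 := exp_int_mul_pi_periodic (-m)
  simp only [Int.cast_one, one_mul, Int.cast_neg, neg_mul] at h1 h2
  rw [h1, h2, sub_self, ← mul_sub] at key
  have := (mul_eq_zero.1 key).resolve_left Complex.I_ne_zero
  linear_combination -this

end Coefficients

/-! ### The generating function of first returns and its second derivative -/

section Renewal

open Real Topology

/-- The generating function `1 - 1 / U` of the first return probabilities, where
`U = latticeIntegral φ 0 / (2 π)`. -/
noncomputable def returnGF (φ : ℝ → ℂ) (s : ℂ) : ℂ := 1 - 2 * π / latticeIntegral φ 0 s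

/-- The derivative of `returnGF`. -/
noncomputable def returnGFDeriv (φ : ℝ → ℂ) (s : ℂ) : ℂ :=
  2 * π * (latticeIntegral φ 1 s / latticeIntegral φ 0 s ^ 2)

/-- The second derivative of `returnGF`. -/
noncomputable def returnGFDeriv₂ (φ : ℝ → ℂ) (s : ℂ) : ℂ :=
  2 * π * (2 * latticeIntegral φ 2 s / latticeIntegral φ 0 s ^ 2
    - 2 * latticeIntegral φ 1 s ^ 2 / latticeIntegral φ 0 s ^ 3)

namespace IsAperiodicSymbol

variable {φ : ℝ → ℂ} {b : ℝ}

lemma hasDerivAt_returnGF (h : IsAperiodicSymbol φ b) {s : ℂ} (hs : ‖s‖ < 1) :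
    HasDerivAt (returnGF φ) (returnGFDeriv φ s) s := by
  have hne := h.latticeIntegral_zero_ne_zero hs
  have h1 := (((h.hasDerivAt_latticeIntegral 0 hs).fun_inv hne).const_mul (2 * π : ℂ)).const_sub 1
  convert! h1 using 1
  simp only [returnGFDeriv, Nat.cast_zero, zero_add, one_mul]
  ring

lemma hasDerivAt_returnGFDeriv (h : IsAperiodicSymbol φ b) {s : ℂ} (hs : ‖s‖ < 1) :
    HasDerivAt (returnGFDeriv φ) (returnGFDeriv₂ φ s) s := by
  have hne := h.latticeIntegral_zero_ne_zero hs
  have h1 := ((h.hasDerivAt_latticeIntegral 1 hs).fun_div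
    ((h.hasDerivAt_latticeIntegral 0 hs).fun_pow 2) (pow_ne_zero 2 hne)).const_mul (2 * π : ℂ)
  convert! h1 using 1
  simp only [returnGFDeriv₂, Nat.cast_zero, zero_add, one_mul, Nat.cast_one]
  norm_num
  field_simp

lemma continuousOn_returnGFDeriv₂ (h : IsAperiodicSymbol φ b) :
    ContinuousOn (returnGFDeriv₂ φ) {s | ‖s‖ < 1} := by
  have hc : ∀ k, ContinuousOn (latticeIntegral φ k) {s | ‖s‖ < 1} := fun k s hs =>
    (h.hasDerivAt_latticeIntegral k hs).continuousAt.continuousWithinAt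
  have h0 := hc 0
  have h1 := hc 1
  have h2 := hc 2
  unfold returnGFDeriv₂
  refine continuousOn_const.mul (((continuousOn_const.mul h2).div (h0.pow 2) fun s hs => ?_).sub
    ((continuousOn_const.mul (h1.pow 2)).div (h0.pow 3) fun s hs => ?_))
  · exact pow_ne_zero _ (h.latticeIntegral_zero_ne_zero hs)
  · exact pow_ne_zero _ (h.latticeIntegral_zero_ne_zero hs)

/-- Write `J k` for the period integrals and `β = ‖1 - s‖`. The lower bound `β ^ (-1/2)` for `J 0`
and the upper bounds `β ^ (-k - 1/2)` for `J k` give order `β ^ (-3/2)` in both `J 2 / J 0 ^ 2` and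
`J 1 ^ 2 / J 0 ^ 3`. -/
lemma exists_norm_returnGFDeriv₂_le (h : IsAperiodicSymbol φ b) :
    ∃ C > 0, ∀ s : ℂ, ‖s‖ < 1 → ‖returnGFDeriv₂ φ s‖ ≤ C / √‖1 - s‖ ^ 3 := by
  obtain ⟨c, hc, h0⟩ := h.exists_le_norm_latticeIntegral_zero
  obtain ⟨C₁, hC₁, h1⟩ := h.exists_norm_latticeIntegral_le 1
  obtain ⟨C₂, hC₂, h2⟩ := h.exists_norm_latticeIntegral_le 2
  have hpi := Real.pi_pos
  refine ⟨2 * π * (2 * C₂ / c ^ 2 + 2 * C₁ ^ 2 / c ^ 3), by positivity, fun s hs => ?_⟩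
  have hβ : 0 < ‖1 - s‖ := norm_pos_iff.2 (sub_ne_zero.2 (by rintro rfl; simp at hs))
  have hq : 0 < √‖1 - s‖ := Real.sqrt_pos.2 hβ
  have hsq : ‖1 - s‖ = √‖1 - s‖ ^ 2 := (Real.sq_sqrt hβ.le).symm
  have h0' := h0 s hs
  have h1' := h1 s hs
  have h2' := h2 s hs
  set q := √‖1 - s‖ with hq_def
  rw [hsq] at h1' h2'
  have e1 : ‖2 * latticeIntegral φ 2 s / latticeIntegral φ 0 s ^ 2‖ ≤ 2 * C₂ / c ^ 2 / q ^ 3 := by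
    rw [norm_div, norm_mul, norm_pow, Complex.norm_ofNat]
    calc _ ≤ 2 * (C₂ / ((q ^ 2) ^ 2 * q)) / (c / q) ^ 2 := by gcongr
      _ = _ := by field_simp
  have e2 : ‖2 * latticeIntegral φ 1 s ^ 2 / latticeIntegral φ 0 s ^ 3‖
      ≤ 2 * C₁ ^ 2 / c ^ 3 / q ^ 3 := by
    rw [norm_div, norm_mul, norm_pow, norm_pow, Complex.norm_ofNat]
    calc _ ≤ 2 * (C₁ / ((q ^ 2) ^ 1 * q)) ^ 2 / (c / q) ^ 3 := by gcongr
      _ = _ := by field_simp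
  have e3 : ‖(2 * π : ℂ)‖ = 2 * π := by
    rw [norm_mul, Complex.norm_ofNat, Complex.norm_real, Real.norm_of_nonneg hpi.le]
  rw [returnGFDeriv₂, norm_mul, e3]
  calc _ ≤ 2 * π * (2 * C₂ / c ^ 2 / q ^ 3 + 2 * C₁ ^ 2 / c ^ 3 / q ^ 3) := by
        gcongr
        exact (norm_sub_le _ _).trans (add_le_add e1 e2)
    _ = _ := by ring

lemma tendsto_returnGFDeriv₂ (h : IsAperiodicSymbol φ b) {s : ℕ → ℂ} {a : ℂ}
    (ha : 0 < a.re) (hs : ∀ᶠ n in atTop, ‖s n‖ < 1)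
    (hsa : Tendsto (fun n : ℕ => (n : ℂ) * (1 - s n)) atTop (𝓝 a)) :
    Tendsto (fun n : ℕ => returnGFDeriv₂ φ (s n) / ((√n : ℝ) : ℂ) ^ 3) atTop
      (𝓝 ((√b / 2 : ℝ) * a ^ (-(3 / 2) : ℂ))) := by
  have h0 := h.tendsto_latticeIntegral 0 ha hs hsa
  have h1 := h.tendsto_latticeIntegral 1 ha hs hsa
  have h2 := h.tendsto_latticeIntegral 2 ha hs hsa
  have hne : resolventIntegral b 0 a ≠ 0 := by
    have ha0 : a ≠ 0 := by rintro rfl; simp at ha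
    have hb := Real.sqrt_pos.2 h.pos
    rw [resolventIntegral_zero h.pos ha]
    refine mul_ne_zero ?_ (by rw [Ne, Complex.cpow_eq_zero_iff]; tauto)
    exact_mod_cast (div_pos Real.pi_pos hb).ne'
  rw [← resolventIntegral_combination h.pos ha]
  refine Tendsto.congr' ?_ ((((h2.const_mul 2).div (h0.pow 2) (pow_ne_zero _ hne)).sub
    (((h1.pow 2).const_mul 2).div (h0.pow 3) (pow_ne_zero _ hne))).const_mul (2 * π : ℂ))
  filter_upwards [hs, eventually_gt_atTop 0] with n hn hn0
  have hn' : (0 : ℝ) < n := by exact_mod_cast hn0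
  have hq : ((√n : ℝ) : ℂ) ≠ 0 := by simpa using (Real.sqrt_pos.2 hn').ne'
  have hJ := h.latticeIntegral_zero_ne_zero hn
  simp only [Pi.div_apply, returnGFDeriv₂, mul_zero, zero_add, mul_one]
  field_simp
  ring

/-- Geometric series in `s φ`, integrated term by term. -/
lemma hasSum_renewal (h : IsAperiodicSymbol φ b) {u : ℕ → ℝ}
    (hu : ∀ n, (u n : ℂ) = (2 * (π : ℂ))⁻¹ * ∫ θ in (-π)..π, φ θ ^ n) {s : ℂ} (hs : ‖s‖ < 1) :
    HasSum (fun n => (u n : ℂ) * s ^ n) ((2 * (π : ℂ))⁻¹ * latticeIntegral φ 0 s) := by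
  have hsub : ∀ θ : ℝ, θ ∈ Set.uIoc (-π) π → θ ∈ Set.Icc (-π) π := fun θ hθ => by
    rw [Set.uIoc_of_le (by linarith [Real.pi_pos])] at hθ
    exact Set.Ioc_subset_Icc_self hθ
  have := h.continuous
  have h1 := intervalIntegral.hasSum_integral_of_dominated_convergence (μ := volume) (a := -π) (b := π)
    (F := fun (k : ℕ) (θ : ℝ) => (s * φ θ) ^ k)
    (f := fun θ : ℝ => φ θ ^ 0 / (1 - s * φ θ) ^ (0 + 1))
    (fun k _ => ‖s‖ ^ k) (fun k => Continuous.aestronglyMeasurable (by fun_prop)) ?_ ?_ ?_ ?_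
  · refine (h1.mul_left ((2 * (π : ℂ))⁻¹ : ℂ)).congr_fun fun n => ?_
    simp_rw [hu, mul_pow]
    rw [intervalIntegral.integral_const_mul]
    ring
  · refine fun k => .of_forall fun θ hθ => ?_
    rw [norm_pow, norm_mul]
    gcongr
    exact mul_le_of_le_one_right (norm_nonneg s) (h.norm_le (hsub θ hθ))
  · exact .of_forall fun t _ => summable_geometric_of_lt_one (norm_nonneg s) hs
  · exact intervalIntegrable_const
  · refine .of_forall fun θ hθ => ?_
    rw [pow_zero, zero_add, pow_one, one_div]
    refine hasSum_geometric_of_norm_lt_one ?_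
    rw [norm_mul]
    exact (mul_le_of_le_one_right (norm_nonneg s) (h.norm_le (hsub θ hθ))).trans_lt hs

/-- The convolution identity says `A U = U - 1`, and `U` has no zero in the disc. -/
lemma hasSum_returnGF (h : IsAperiodicSymbol φ b) {u a : ℕ → ℝ}
    (hu : ∀ n, (u n : ℂ) = (2 * (π : ℂ))⁻¹ * ∫ θ in (-π)..π, φ θ ^ n) (ha : ∀ n, ‖(a n : ℂ)‖ ≤ 1)
    (ha0 : a 0 = 0)
    (hren : ∀ n, 1 ≤ n → u n = ∑ p ∈ Finset.HasAntidiagonal.antidiagonal n, a p.1 * u p.2)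
    {s : ℂ} (hs : ‖s‖ < 1) :
    HasSum (fun n => (a n : ℂ) * s ^ n) (returnGF φ s) := by
  have hpi : (2 * π : ℂ) ≠ 0 := by simp
  have hu0 : u 0 = 1 := by
    have h1 := hu 0
    simp only [pow_zero, intervalIntegral.integral_const, Complex.real_smul] at h1
    rw [← Complex.ofReal_inj, h1]
    push_cast
    field_simp
    ring
  have hU := h.hasSum_renewal hu hs
  have hAn : Summable fun n => ‖(a n : ℂ) * s ^ n‖ := by
    refine (summable_geometric_of_lt_one (norm_nonneg s) hs).of_nonneg_of_le
      (fun n => norm_nonneg _) fun n => ?_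
    rw [norm_mul, norm_pow]
    exact mul_le_of_le_one_left (by positivity) (ha n)
  have hprod := tsum_mul_tsum_eq_tsum_sum_antidiagonal_of_summable_norm hAn hU.summable.norm
  -- The renewal identity fails only at `n = 0`, where the left side is `0` and `u 0 = 1`.
  have hconv : ∀ n, ∑ p ∈ Finset.HasAntidiagonal.antidiagonal n,
      ((a p.1 : ℂ) * s ^ p.1) * ((u p.2 : ℂ) * s ^ p.2)
      = (u n : ℂ) * s ^ n - if n = 0 then 1 else 0 := by
    intro n
    have h1 : ∑ p ∈ Finset.HasAntidiagonal.antidiagonal n, ((a p.1 : ℂ) * s ^ p.1) * ((u p.2 : ℂ) * s ^ p.2)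
        = ((∑ p ∈ Finset.HasAntidiagonal.antidiagonal n, a p.1 * u p.2 : ℝ) : ℂ) * s ^ n := by
      rw [Complex.ofReal_sum, Finset.sum_mul]
      refine Finset.sum_congr rfl fun p hp => ?_
      rw [← Finset.HasAntidiagonal.mem_antidiagonal.1 hp, pow_add]
      push_cast
      ring
    rw [h1]
    rcases Nat.eq_zero_or_pos n with rfl | hn
    · simp [ha0, hu0]
    · rw [← hren n hn, if_neg hn.ne', sub_zero]
  simp_rw [hconv] at hprod
  rw [(hU.sub (hasSum_ite_eq 0 (1 : ℂ))).tsum_eq, hU.tsum_eq] at hprod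
  have hJ := h.latticeIntegral_zero_ne_zero hs
  have : ∑' n, (a n : ℂ) * s ^ n = returnGF φ s := by
    rw [returnGF]
    field_simp at hprod ⊢
    linear_combination hprod
  rw [← this]
  exact hAn.of_norm.hasSum

/-- Two integrations by parts. The first yields the factor `n` and a factor `s = r e ^ (i t)`, whose
exponential lowers the frequency to `n - 1`; the second therefore yields `n - 1`. -/
lemma mul_pred_mul_coeff_eq (h : IsAperiodicSymbol φ b) {a : ℕ → ℂ} (ha : ∀ n, ‖a n‖ ≤ 1)
    (hA : ∀ s : ℂ, ‖s‖ < 1 → HasSum (fun n => a n * s ^ n) (returnGF φ s)) {r : ℝ} (hr0 : 0 ≤ r)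
    (hr1 : r < 1) (n : ℕ) :
    n * (n - 1) * (2 * π * r ^ n * a n)
      = ∫ t in (-π)..π, (r * Complex.exp (t * Complex.I)) ^ 2
        * returnGFDeriv₂ φ (r * Complex.exp (t * Complex.I))
        * Complex.exp (-(n * t * Complex.I)) := by
  have hc : ContinuousOn (returnGFDeriv φ) {s | ‖s‖ < 1} := fun s hs =>
    (h.hasDerivAt_returnGFDeriv hs).continuousAt.continuousWithinAt
  have h1 := int_mul_integral_circle (fun s hs => h.hasDerivAt_returnGF hs) hc hr0 hr1 n
  have h2 := int_mul_integral_circle (fun s hs => h.hasDerivAt_returnGFDeriv hs)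
    h.continuousOn_returnGFDeriv₂ hr0 hr1 (n - 1)
  rw [← integral_circle_eq_coeff ha hA hr0 hr1 n]
  have e : ∀ t : ℝ, Complex.exp (-(((n - 1 : ℤ) : ℂ) * t * Complex.I))
      = Complex.exp (t * Complex.I) * Complex.exp (-(n * t * Complex.I)) := fun t => by
    rw [← Complex.exp_add]
    congr 1
    push_cast
    ring
  simp_rw [e] at h2
  push_cast at h1 h2
  rw [mul_comm (n : ℂ), mul_assoc, h1]
  have e2 : ∀ t : ℝ, (r * Complex.exp (t * Complex.I)) * returnGFDeriv φ (r * Complex.exp (t * Complex.I))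
        * Complex.exp (-(n * t * Complex.I)) = r * (returnGFDeriv φ (r * Complex.exp (t * Complex.I))
        * (Complex.exp (t * Complex.I) * Complex.exp (-(n * t * Complex.I)))) := fun t => by ring
  simp_rw [e2]
  rw [intervalIntegral.integral_const_mul, mul_left_comm, h2, ← intervalIntegral.integral_const_mul]
  congr 1 with t
  ring

end IsAperiodicSymbol

end Renewal

/-! ### Asymptotics of the coefficients -/

section Asymptotics

open Real Topology

lemma tendsto_mul_one_sub_exp (z : ℂ) :
    Tendsto (fun n : ℕ => (n : ℂ) * (1 - Complex.exp (z / n))) atTop (𝓝 (-z)) := by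
  have h1 : HasDerivAt (fun w : ℂ => Complex.exp (z * w)) z 0 := by
    simpa using ((hasDerivAt_id (0 : ℂ)).const_mul z).cexp
  have h2 : Tendsto (fun n : ℕ => ((n : ℂ))⁻¹) atTop (𝓝[≠] 0) := by
    refine tendsto_nhdsWithin_iff.2 ⟨tendsto_inv_atTop_nhds_zero_nat, ?_⟩
    filter_upwards [eventually_gt_atTop 0] with n hn
    simp [hn.ne']
  refine (h1.tendsto_slope_zero.comp h2).neg.congr fun n => ?_
  simp only [Function.comp_apply, inv_inv, smul_eq_mul, zero_add, mul_zero, Complex.exp_zero]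
  rw [div_eq_mul_inv]
  ring

/-- A point of the circle of radius `exp (-1 / n)`, seen from the point `1`. -/
lemma le_norm_one_sub_circle {n : ℕ} (hn : 0 < n) {x : ℝ} (hx : |x / n| ≤ π) :
    2 * rexp (-1) / π * √(1 + x ^ 2)
      ≤ n * ‖1 - (rexp (-(1 / n)) : ℂ) * Complex.exp ((x / n : ℝ) * Complex.I)‖ := by
  have hn' : (1 : ℝ) ≤ n := by exact_mod_cast hn
  have hn0 : (0 : ℝ) < n := by linarith
  have hpi := Real.pi_pos
  set r := rexp (-(1 / n)) with hr
  set t := x / n with ht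
  have hinv : 1 / (n : ℝ) ≤ 1 := by rw [div_le_one hn0]; exact hn'
  have hre : rexp (-1) ≤ r := Real.exp_le_exp.2 (by linarith)
  have he : 0 < rexp (-1) := Real.exp_pos _
  have he1 : rexp (-1) ≤ 1 := Real.exp_le_one_iff.2 (by norm_num)
  have h1r : rexp (-1) / n ≤ 1 - r := by
    have h1 : 1 / (n : ℝ) + 1 ≤ rexp (1 / n) := Real.add_one_le_exp _
    have h2 : rexp (1 / n) * r = 1 := by rw [hr, ← Real.exp_add]; simp
    have h3 : r * (1 / n) ≤ 1 - r := by nlinarith [Real.exp_pos (-(1 / (n : ℝ)))]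
    calc rexp (-1) / n = rexp (-1) * (1 / n) := by ring
      _ ≤ r * (1 / n) := by gcongr
      _ ≤ _ := h3
  -- Used as `1 - cos t ≥ 2 t ^ 2 / π ^ 2` on `[-π, π]`, which bounds the angular part of `‖1 - r e
  -- ^ (i t)‖ ^ 2 = (1 - r) ^ 2 + 2 r (1 - cos t)`.
  have hcos := Real.cos_le_one_sub_mul_cos_sq hx
  have hsq : ‖1 - (r : ℂ) * Complex.exp (t * Complex.I)‖ ^ 2
      = (1 - r) ^ 2 + 2 * r * (1 - Real.cos t) := by
    rw [Complex.sq_norm, Complex.normSq_apply]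
    simp only [Complex.sub_re, Complex.one_re, Complex.re_ofReal_mul, Complex.exp_ofReal_mul_I_re,
      Complex.sub_im, Complex.one_im, Complex.im_ofReal_mul, Complex.exp_ofReal_mul_I_im]
    linear_combination r ^ 2 * Real.sin_sq_add_cos_sq t
  have hxt : x = t * n := by rw [ht]; field_simp
  refine (sq_le_sq₀ (by positivity) (by positivity)).1 ?_
  rw [mul_pow, mul_pow, hsq, Real.sq_sqrt (by positivity), div_pow, mul_pow]
  have h4 : rexp (-1) ≤ (1 - r) * n := by rwa [div_le_iff₀ hn0] at h1r
  have h5 : rexp (-1) ^ 2 ≤ ((1 - r) * n) ^ 2 := by gcongr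
  have h6 : 2 ^ 2 * rexp (-1) ^ 2 / π ^ 2 ≤ rexp (-1) ^ 2 := by
    rw [div_le_iff₀ (by positivity), mul_comm]
    gcongr
    linarith [Real.pi_gt_three]
  have h7 : 2 ^ 2 * rexp (-1) ^ 2 / π ^ 2 * x ^ 2 ≤ n ^ 2 * (2 * r * (1 - Real.cos t)) := by
    have h8 : 2 / π ^ 2 * t ^ 2 ≤ 1 - Real.cos t := by linarith
    have h9 : rexp (-1) ^ 2 ≤ r := by nlinarith
    calc 2 ^ 2 * rexp (-1) ^ 2 / π ^ 2 * x ^ 2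
        = n ^ 2 * (2 * rexp (-1) ^ 2 * (2 / π ^ 2 * t ^ 2)) := by rw [hxt]; ring
      _ ≤ _ := by gcongr
  nlinarith

namespace IsAperiodicSymbol

variable {φ : ℝ → ℂ} {b : ℝ}

/-- With `t = x / n` the point on the circle is `s = exp (-(1 - i x) / n)`, so `n (1 - s)` tends to
`1 - i x`, of real part `1`. The second derivative grows like `n ^ (3/2)` and `dt = dx / n`, which
leaves `√n`. The size bound gives the integrable majorant `(1 + x ^ 2) ^ (-3/4)`. -/
lemma tendsto_integral_returnGFDeriv₂ (h : IsAperiodicSymbol φ b) :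
    Tendsto (fun n : ℕ => (∫ t in (-π)..π, ((rexp (-(1 / n)) : ℂ) * Complex.exp (t * Complex.I)) ^ 2
        * returnGFDeriv₂ φ ((rexp (-(1 / n)) : ℂ) * Complex.exp (t * Complex.I))
        * Complex.exp (-(n * t * Complex.I))) / ((√n : ℝ) : ℂ)) atTop
      (𝓝 ((√b / 2 : ℝ) * (4 * √π * rexp (-1) : ℝ))) := by
  have hpi := Real.pi_pos
  obtain ⟨C, hC, hbound⟩ := h.exists_norm_returnGFDeriv₂_le
  set c := 2 * rexp (-1) / π with hc_def
  have hc : 0 < c := by positivity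
  let S : ℕ → ℝ → ℂ := fun n t => (rexp (-(1 / n)) : ℂ) * Complex.exp (t * Complex.I)
  let f : ℕ → ℝ → ℂ := fun n => (Set.Ioc (-π) π).indicator fun t =>
    S n t ^ 2 * returnGFDeriv₂ φ (S n t) * Complex.exp (-(n * t * Complex.I))
  have hSnorm : ∀ n : ℕ, 0 < n → ∀ t, ‖S n t‖ < 1 := fun n hn t => by
    rw [norm_circle_point (Real.exp_pos _).le]
    have : (0 : ℝ) < 1 / n := by positivity
    exact Real.exp_lt_one_iff.2 (by linarith)
  rw [← integral_one_sub_mul_I_cpow_mul_cexp, ← integral_const_mul]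
  refine Tendsto.congr' (f₁ := fun n : ℕ => ∫ x : ℝ, f n (x / n) / ((√n : ℝ) : ℂ) ^ 3) ?_ ?_
  · filter_upwards [eventually_gt_atTop 0] with n hn
    have hn' : (0 : ℝ) < n := by exact_mod_cast hn
    have hsq : (n : ℂ) = ((√n : ℝ) : ℂ) ^ 2 := by
      rw [← Complex.ofReal_pow, Real.sq_sqrt hn'.le, Complex.ofReal_natCast]
    have hne : ((√n : ℝ) : ℂ) ≠ 0 := by
      simpa using (Real.sqrt_pos.2 hn').ne'
    rw [integral_div, Measure.integral_comp_div (f n), abs_of_nonneg hn'.le,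
      intervalIntegral.integral_of_le (by linarith), ← integral_indicator measurableSet_Ioc,
      Complex.real_smul, Complex.ofReal_natCast]
    change (n : ℂ) * (∫ t, f n t) / _ = (∫ t, f n t) / _
    rw [hsq]
    field_simp
  refine tendsto_integral_filter_of_dominated_convergence
    (fun x => C / √c ^ 3 * (1 + x ^ 2) ^ (-(3 / 4) : ℝ)) ?_ ?_
    (integrable_one_add_sq_rpow.const_mul _) ?_
  · filter_upwards [eventually_gt_atTop 0] with n hn
    have hS : Continuous (S n) := by fun_prop
    have h1 : Continuous fun t => returnGFDeriv₂ φ (S n t) :=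
      h.continuousOn_returnGFDeriv₂.comp_continuous hS (hSnorm n hn)
    have h2 : Measurable (f n) :=
      Measurable.indicator (Continuous.measurable (by fun_prop)) measurableSet_Ioc
    exact Measurable.aestronglyMeasurable (by fun_prop)
  · filter_upwards [eventually_gt_atTop 0] with n hn
    refine .of_forall fun x => ?_
    have hn' : (0 : ℝ) < n := by exact_mod_cast hn
    by_cases hx : x / n ∈ Set.Ioc (-π) π
    · have hlow := le_norm_one_sub_circle hn (x := x) (abs_le.2 ⟨hx.1.le, hx.2⟩)
      rw [← hc_def] at hlow
      have hS := hSnorm n hn (x / n)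
      simp only [f, Set.indicator_of_mem hx]
      have h1 : ‖S n (x / n) ^ 2 * returnGFDeriv₂ φ (S n (x / n))
          * Complex.exp (-(n * (x / n : ℝ) * Complex.I))‖ ≤ C / √‖1 - S n (x / n)‖ ^ 3 := by
        have h2 : ‖Complex.exp (-(n * (x / n : ℝ) * Complex.I))‖ = 1 := by
          rw [Complex.norm_exp]; simp
        rw [norm_mul, norm_mul, norm_pow, h2, mul_one]
        exact (mul_le_of_le_one_left (norm_nonneg _) (pow_le_one₀ (norm_nonneg _) hS.le)).trans
          (hbound _ hS)
      rw [norm_div, norm_pow, Complex.norm_real, Real.norm_of_nonneg (Real.sqrt_nonneg _)]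
      have h3 : √c ^ 3 * (1 + x ^ 2) ^ (3 / 4 : ℝ) ≤ √‖1 - S n (x / n)‖ ^ 3 * √n ^ 3 := by
        have h4 : (1 + x ^ 2) ^ (3 / 4 : ℝ) = √(√(1 + x ^ 2)) ^ 3 := by
          rw [Real.sqrt_eq_rpow, Real.sqrt_eq_rpow, ← Real.rpow_mul (by positivity),
            ← Real.rpow_mul_natCast (by positivity)]
          norm_num
        rw [h4, ← mul_pow, ← mul_pow, ← Real.sqrt_mul hc.le, ← Real.sqrt_mul (norm_nonneg _),
          mul_comm ‖_‖]
        gcongr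
      have h5 : 0 < √c ^ 3 * (1 + x ^ 2) ^ (3 / 4 : ℝ) := by positivity
      calc _ ≤ C / √‖1 - S n (x / n)‖ ^ 3 / √n ^ 3 := by gcongr
        _ = C / (√‖1 - S n (x / n)‖ ^ 3 * √n ^ 3) := div_div _ _ _
        _ ≤ C / (√c ^ 3 * (1 + x ^ 2) ^ (3 / 4 : ℝ)) := by gcongr
        _ = _ := by rw [Real.rpow_neg (by positivity), ← div_div, div_eq_mul_inv (C / _)]
    · simp only [f, Set.indicator_of_notMem hx, zero_div, norm_zero]
      positivity
  · refine .of_forall fun x => ?_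
    have hseq : ∀ n : ℕ, S n (x / n) = Complex.exp (-(1 - (x : ℂ) * Complex.I) / n) := fun n => by
      simp only [S]
      rw [Complex.ofReal_exp, ← Complex.exp_add]
      congr 1
      push_cast
      ring
    have hsa : Tendsto (fun n : ℕ => (n : ℂ) * (1 - S n (x / n))) atTop
        (𝓝 (1 - (x : ℂ) * Complex.I)) := by
      simp_rw [hseq]
      simpa only [neg_neg] using tendsto_mul_one_sub_exp (-(1 - (x : ℂ) * Complex.I))
    have hs : ∀ᶠ n : ℕ in atTop, ‖S n (x / n)‖ < 1 := by
      filter_upwards [eventually_gt_atTop 0] with n hn using hSnorm n hn _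
    have hlim := h.tendsto_returnGFDeriv₂ (by rw [one_sub_mul_I_re]; exact one_pos) hs hsa
    have hS1 : Tendsto (fun n : ℕ => S n (x / n)) atTop (𝓝 1) := by
      have h2 : Tendsto (fun n : ℕ => -(1 - (x : ℂ) * Complex.I) / n) atTop (𝓝 0) :=
        tendsto_const_div_atTop_nhds_zero_nat _
      have h3 := (Complex.continuous_exp.tendsto 0).comp h2
      rw [Complex.exp_zero] at h3
      exact h3.congr fun n => (hseq n).symm
    have h4 := ((hS1.pow 2).mul hlim).mul_const (Complex.exp (-(x * Complex.I)))
    rw [one_pow, one_mul, mul_assoc] at h4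
    refine h4.congr' ?_
    have hx0 : Tendsto (fun n : ℕ => x / (n : ℝ)) atTop (𝓝 0) :=
      tendsto_const_div_atTop_nhds_zero_nat _
    filter_upwards [hx0.eventually (Ioc_mem_nhds (by linarith : -π < 0) hpi),
      eventually_gt_atTop 0] with n hn hn0
    have hn' : (n : ℂ) ≠ 0 := by exact_mod_cast hn0.ne'
    have hmem : x / (n : ℝ) ∈ Set.Ioc (-π) π := hn
    simp only [f, Set.indicator_of_mem hmem]
    have h5 : (n : ℂ) * ((x / n : ℝ) : ℂ) = x := by
      push_cast
      field_simp
    rw [h5]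
    ring

/-- The asymptotics of the first return probabilities attached to a renewal sequence of the form
`u n = (2 π)⁻¹ ∫ φ ^ n`. -/
theorem tendsto_first_return (h : IsAperiodicSymbol φ b) {u a : ℕ → ℝ}
    (hu : ∀ n, (u n : ℂ) = (2 * (π : ℂ))⁻¹ * ∫ θ in (-π)..π, φ θ ^ n) (ha : ∀ n, |a n| ≤ 1)
    (ha0 : a 0 = 0)
    (hren : ∀ n, 1 ≤ n → u n = ∑ p ∈ Finset.HasAntidiagonal.antidiagonal n, a p.1 * u p.2) :
    Tendsto (fun n : ℕ => a n * (n : ℝ) ^ (3 / 2 : ℝ)) atTop (𝓝 (√(b / π))) := by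
  have hpi := Real.pi_pos
  have ha' : ∀ n, ‖(a n : ℂ)‖ ≤ 1 := fun n => by rw [Complex.norm_real]; exact ha n
  have h1 := h.tendsto_integral_returnGFDeriv₂
  have h2 : Tendsto (fun n : ℕ => n * (n - 1) * (2 * π * rexp (-1) * a n) / √n) atTop
      (𝓝 (√b / 2 * (4 * √π * rexp (-1)))) := by
    rw [← Complex.ofReal_mul] at h1
    refine ((Complex.continuous_re.tendsto _).comp h1).congr' ?_
    filter_upwards [eventually_gt_atTop 0] with n hn
    have hn' : (0 : ℝ) < n := by exact_mod_cast hn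
    have hr1 : rexp (-(1 / n)) < 1 := by
      have : (0 : ℝ) < 1 / n := by positivity
      exact Real.exp_lt_one_iff.2 (by linarith)
    have h3 := h.mul_pred_mul_coeff_eq ha' (fun s hs => h.hasSum_returnGF hu ha' ha0 hren hs)
      (Real.exp_pos _).le hr1 n
    -- On this radius `r ^ n` is the constant `e⁻¹`, which cancels the `e⁻¹` of the limiting
    -- integral.
    have h4 : (rexp (-(1 / n)) : ℂ) ^ n = rexp (-1) := by
      rw [← Complex.ofReal_pow, ← Real.exp_nat_mul]
      congr 2
      field_simp
    rw [Function.comp_apply, ← h3, h4]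
    rw [← Complex.ofReal_re (n * (n - 1) * (2 * π * rexp (-1) * a n) / √n)]
    congr 1
    push_cast
    rfl
  have h5 : Tendsto (fun n : ℕ => (n : ℝ) / (n - 1)) atTop (𝓝 1) := by
    have h6 : Tendsto (fun n : ℕ => (1 - (n : ℝ)⁻¹)⁻¹) atTop (𝓝 1) := by
      have := (tendsto_inv_atTop_nhds_zero_nat (𝕜 := ℝ)).const_sub 1
      simpa using this.inv₀ (by norm_num)
    refine h6.congr' ?_
    filter_upwards [eventually_gt_atTop 0] with n hn
    have hn' : (n : ℝ) ≠ 0 := by exact_mod_cast hn.ne'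
    rw [← inv_div, sub_div, div_self hn', one_div]
  have h7 := (h2.mul h5).div_const (2 * π * rexp (-1))
  have hval : √b / 2 * (4 * √π * rexp (-1)) * 1 / (2 * π * rexp (-1)) = √(b / π) := by
    rw [Real.sqrt_div h.pos.le]
    have h8 := Real.sq_sqrt hpi.le
    have h9 : 0 < √π := Real.sqrt_pos.2 hpi
    have h10 := Real.exp_pos (-1)
    nth_rewrite 2 [← h8]
    field_simp
    norm_num
  rw [hval] at h7
  refine h7.congr' ?_
  filter_upwards [eventually_gt_atTop 1] with n hn
  have hn' : (1 : ℝ) < n := by exact_mod_cast hn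
  have hn1 : (n : ℝ) - 1 ≠ 0 := by linarith
  have hn0 : (0 : ℝ) < n := by linarith
  have hq : 0 < √(n : ℝ) := Real.sqrt_pos.2 hn0
  have h11 : (n : ℝ) ^ (3 / 2 : ℝ) = n * √n := by
    rw [show (3 / 2 : ℝ) = 1 + 1 / 2 by norm_num, Real.rpow_add hn0, Real.rpow_one,
      ← Real.sqrt_eq_rpow]
  rw [h11]
  have h12 := Real.sq_sqrt hn0.le
  field_simp
  rw [h12, mul_comm]

end IsAperiodicSymbol

end Asymptotics

/-! ### Return probabilities as integrals of characteristic functions -/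

section CharFun

open Real Topology

variable {Ω : Type*} [MeasurableSpace Ω] {μ : Measure Ω}

lemma charFun_map_intCast {Z : Ω → ℤ} (hZ : AEMeasurable Z μ) (θ : ℝ) :
    charFun (μ.map fun ω => (Z ω : ℝ)) θ = ∫ ω, Complex.exp (Z ω * θ * Complex.I) ∂μ := by
  have hZ' : AEMeasurable (fun ω => (Z ω : ℝ)) μ := (measurable_from_top (f := fun z : ℤ => (z : ℝ))).comp_aemeasurable hZ
  rw [charFun_apply_real, integral_map hZ' (by fun_prop)]
  congr 1 with ω
  push_cast
  ring_nf

/-- Fourier inversion for the mass at `0` of an integer-valued random variable. -/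
lemma measureReal_eq_zero_eq_integral_charFun [IsProbabilityMeasure μ] {Z : Ω → ℤ}
    (hZ : AEMeasurable Z μ) :
    (μ.real {ω | Z ω = 0} : ℂ)
      = (2 * (π : ℂ))⁻¹ * ∫ θ in (-π)..π, charFun (μ.map fun ω => (Z ω : ℝ)) θ := by
  have hpi := Real.pi_pos
  simp_rw [charFun_map_intCast hZ]
  rw [intervalIntegral.integral_of_le (by linarith), integral_integral_swap]
  · have h1 : ∀ ω, ∫ θ in Set.Ioc (-π) π, Complex.exp (Z ω * θ * Complex.I)
        = {ω | Z ω = 0}.indicator (fun _ => (2 * π : ℂ)) ω := fun ω => by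
      rw [← intervalIntegral.integral_of_le (by linarith), integral_exp_int_mul]
      simp [Set.indicator]
    simp_rw [h1]
    have h2 : NullMeasurableSet {ω | Z ω = 0} μ :=
      hZ.nullMeasurable (measurableSet_singleton (0 : ℤ))
    rw [integral_indicator₀ h2, setIntegral_const, Complex.real_smul]
    have : (π : ℂ) ≠ 0 := by simp
    field_simp
  · refine Integrable.of_bound (C := 1) ?_ (.of_forall fun p => ?_)
    · have h3 : AEMeasurable (fun p : ℝ × Ω => (Z p.2 : ℂ))
          ((volume.restrict (Set.Ioc (-π) π)).prod μ) :=
        (measurable_from_top (f := fun z : ℤ => (z : ℂ))).comp_aemeasurable hZ.comp_snd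
      refine AEMeasurable.aestronglyMeasurable ?_
      simp only [Function.uncurry_def]
      fun_prop
    · rw [Function.uncurry_def, Complex.norm_exp]
      simp

variable {X : ℕ → Ω → ℤ}

lemma charFun_map_sum_eq_pow [IsProbabilityMeasure μ] (hindep : iIndepFun X μ)
    (hident : ∀ j, IdentDistrib (X j) (X 0) μ μ) (s : Finset ℕ) (θ : ℝ) :
    charFun (μ.map fun ω => ((∑ j ∈ s, X j ω : ℤ) : ℝ)) θ
      = charFun (μ.map fun ω => (X 0 ω : ℝ)) θ ^ s.card := by
  have hm : Measurable fun z : ℤ => (z : ℝ) := measurable_from_top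
  have hX : ∀ j, AEMeasurable (fun ω => (X j ω : ℝ)) μ := fun j =>
    hm.comp_aemeasurable (hident j).aemeasurable_fst
  have hi : iIndepFun (fun j ω => (X j ω : ℝ)) μ := hindep.comp (fun _ z => (z : ℝ)) fun _ => hm
  have h1 := (hi.restrict s).charFun_map_fun_finsetSum_eq_prod (fun j _ => hX j)
  push_cast
  rw [h1, Finset.prod_apply, Finset.prod_congr rfl (g := fun _ =>
    charFun (μ.map fun ω => (X 0 ω : ℝ)) θ) fun j _ => ?_, Finset.prod_const]
  exact congrArg (fun ν => charFun ν θ) ((hident j).comp hm).map_eq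

/-- The right side depends on `s` only through its cardinality. Besides the formula for `u n`, this
gives the stationarity of block sums needed for renewal. -/
lemma measureReal_sum_eq_zero [IsProbabilityMeasure μ] (hindep : iIndepFun X μ)
    (hident : ∀ j, IdentDistrib (X j) (X 0) μ μ) (s : Finset ℕ) :
    (μ.real {ω | ∑ j ∈ s, X j ω = 0} : ℂ)
      = (2 * (π : ℂ))⁻¹ * ∫ θ in (-π)..π, charFun (μ.map fun ω => (X 0 ω : ℝ)) θ ^ s.card := by
  rw [measureReal_eq_zero_eq_integral_charFun
    (Finset.aemeasurable_fun_sum s fun j _ => (hident j).aemeasurable_fst)]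
  simp_rw [charFun_map_sum_eq_pow hindep hident]

end CharFun

/-! ### Decomposition at the first return -/

section FirstReturn

variable {Ω : Type*} {X : ℕ → Ω → ℤ}

lemma firstReturnTime_eq_coe_iff {ω : Ω} {k : ℕ} : firstReturnTime X ω = k ↔
    1 ≤ k ∧ walk X k ω = 0 ∧ ∀ m, 1 ≤ m → m < k → walk X m ω ≠ 0 := by
  classical
  by_cases h : ∃ k, 1 ≤ k ∧ walk X k ω = 0
  · have h1 : firstReturnTime X ω = (Nat.find h : ℕ) := by
      refine le_antisymm (iInf₂_le (Nat.find h) (Nat.find_spec h)) (le_iInf₂ fun m hm => ?_)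
      exact_mod_cast Nat.find_min' h hm
    rw [h1, Nat.cast_inj, Nat.find_eq_iff]
    refine ⟨fun ⟨h2, h3⟩ => ⟨h2.1, h2.2, fun m hm hmk h0 => h3 m hmk ⟨hm, h0⟩⟩,
      fun ⟨h2, h3, h4⟩ => ⟨⟨h2, h3⟩, fun m hmk h0 => h4 m h0.1 hmk h0.2⟩⟩
  · have h1 : firstReturnTime X ω = ⊤ := by
      simp only [firstReturnTime, iInf_eq_top]
      exact fun m hm => (h ⟨m, hm⟩).elim
    rw [h1]
    refine ⟨fun h2 => (ENat.natCast_ne_top k h2.symm).elim, fun h2 => (h ⟨k, h2.1, h2.2.1⟩).elim⟩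

variable [MeasurableSpace Ω] {μ : Measure Ω}

lemma aemeasurable_walk (hX : ∀ j, AEMeasurable (X j) μ) (n : ℕ) : AEMeasurable (walk X n) μ :=
  Finset.aemeasurable_fun_sum _ fun j _ => hX j

lemma nullMeasurableSet_firstReturnTime (hX : ∀ j, AEMeasurable (X j) μ) (k : ℕ) :
    NullMeasurableSet {ω | firstReturnTime X ω = k} μ := by
  have h1 : {ω | firstReturnTime X ω = k} = {_ω : Ω | 1 ≤ k} ∩ ({ω | walk X k ω = 0} ∩
      ⋂ m ∈ Finset.Ico 1 k, {ω | walk X m ω = 0}ᶜ) := by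
    ext ω
    simp only [Set.mem_ofPred_eq, firstReturnTime_eq_coe_iff, Set.mem_inter_iff, Set.mem_iInter,
      Finset.mem_Ico, Set.mem_compl_iff, and_imp, ne_eq]
  have h2 : ∀ m, NullMeasurableSet {ω | walk X m ω = 0} μ := fun m =>
    (aemeasurable_walk hX m).nullMeasurable (measurableSet_singleton (0 : ℤ))
  rw [h1]
  exact (MeasurableSet.const _).nullMeasurableSet.inter ((h2 k).inter
    (NullMeasurableSet.biInter (Finset.Ico 1 k).countable_toSet fun m _ => (h2 m).compl))

/-- The event `τ = k` depends only on the first `k` increments, and on it the walk at time `n` is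
the sum of the increments from `k` to `n - 1`, which are independent of those. -/
lemma measureReal_firstReturnTime_inter [IsProbabilityMeasure μ] (hindep : iIndepFun X μ)
    (hX : ∀ j, AEMeasurable (X j) μ) {k n : ℕ} (hkn : k ≤ n) :
    μ.real ({ω | firstReturnTime X ω = k} ∩ {ω | walk X n ω = 0})
      = firstReturnProb μ X k * μ.real {ω | ∑ j ∈ Finset.Ico k n, X j ω = 0} := by
  have hdisj : Disjoint (Finset.range k) (Finset.Ico k n) := by
    rw [Finset.disjoint_left]
    intro j hj hj'
    simp only [Finset.mem_range, Finset.mem_Ico] at hj hj'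
    omega
  have hi := hindep.indepFun_finset₀ _ _ hdisj hX
  -- Extension by zero, so that partial sums of a finite vector can be written over `Finset.range
  -- m`.
  let e : (Finset.range k → ℤ) → ℕ → ℤ := fun x j =>
    if h : j ∈ Finset.range k then x ⟨j, h⟩ else 0
  let A : Set (Finset.range k → ℤ) := {x | 1 ≤ k ∧ ∑ j ∈ Finset.range k, e x j = 0 ∧
    ∀ m, 1 ≤ m → m < k → ∑ j ∈ Finset.range m, e x j ≠ 0}
  let B : Set (Finset.Ico k n → ℤ) := {x | ∑ j, x j = 0}
  have he : ∀ ω, ∀ m ≤ k, ∑ j ∈ Finset.range m, e (fun i => X i ω) j = walk X m ω := by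
    intro ω m hm
    refine Finset.sum_congr rfl fun j hj => ?_
    have : j ∈ Finset.range k := Finset.mem_range.2 ((Finset.mem_range.1 hj).trans_le hm)
    simp only [e, dif_pos this]
  have hA : (fun ω (i : Finset.range k) => X i ω) ⁻¹' A = {ω | firstReturnTime X ω = k} := by
    ext ω
    simp only [A, Set.mem_preimage, Set.mem_ofPred_eq, firstReturnTime_eq_coe_iff]
    rw [he ω k le_rfl]
    refine and_congr_right fun _ => and_congr_right fun _ => forall_congr' fun m =>
      forall_congr' fun _ => forall_congr' fun hm => ?_
    rw [he ω m hm.le]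
  have hB : (fun ω (i : Finset.Ico k n) => X i ω) ⁻¹' B
      = {ω | ∑ j ∈ Finset.Ico k n, X j ω = 0} := by
    ext ω
    simp only [B, Set.mem_preimage, Set.mem_ofPred_eq]
    rw [Finset.sum_coe_sort (Finset.Ico k n) fun j => X j ω]
  have h1 := congrArg ENNReal.toReal (hi.measure_inter_preimage_eq_mul A B (Set.Countable.measurableSet A.to_countable)
    (Set.Countable.measurableSet B.to_countable))
  rw [hA, hB, ENNReal.toReal_mul] at h1
  simp only [firstReturnProb, measureReal_def]
  rw [← h1]
  congr 2
  ext ω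
  simp only [Set.mem_inter_iff, Set.mem_ofPred_eq]
  refine and_congr_right fun hω => ?_
  have h2 : walk X n ω = walk X k ω + ∑ j ∈ Finset.Ico k n, X j ω :=
    (Finset.sum_range_add_sum_Ico _ hkn).symm
  rw [h2, (firstReturnTime_eq_coe_iff.1 hω).2.1, zero_add]

/-- If `S n = 0` with `n ≥ 1`, then the first return happens at some `k ≤ n`, after which the walk
starts afresh. The term `k = 0` is harmless, as `τ ≥ 1`. -/
lemma renewal_equation [IsProbabilityMeasure μ] (hindep : iIndepFun X μ)
    (hident : ∀ j, IdentDistrib (X j) (X 0) μ μ) {n : ℕ} (hn : 1 ≤ n) :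
    μ.real {ω | walk X n ω = 0} = ∑ p ∈ Finset.HasAntidiagonal.antidiagonal n,
      firstReturnProb μ X p.1 * μ.real {ω | walk X p.2 ω = 0} := by
  have hX : ∀ j, AEMeasurable (X j) μ := fun j => (hident j).aemeasurable_fst
  have hsum : ∀ s t : Finset ℕ, s.card = t.card →
      μ.real {ω | ∑ j ∈ s, X j ω = 0} = μ.real {ω | ∑ j ∈ t, X j ω = 0} := fun s t hst => by
    rw [← Complex.ofReal_inj, measureReal_sum_eq_zero hindep hident,
      measureReal_sum_eq_zero hindep hident, hst]
  have hunion : {ω | walk X n ω = 0} = ⋃ k ∈ Finset.range (n + 1),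
      ({ω | firstReturnTime X ω = k} ∩ {ω | walk X n ω = 0}) := by
    ext ω
    simp only [Set.mem_iUnion, Set.mem_inter_iff, Set.mem_ofPred_eq, Finset.mem_range, exists_prop]
    refine ⟨fun h => ?_, fun ⟨k, _, _, h⟩ => h⟩
    classical
    have hex : ∃ k, 1 ≤ k ∧ walk X k ω = 0 := ⟨n, hn, h⟩
    refine ⟨Nat.find hex, Nat.lt_succ_of_le (Nat.find_min' hex ⟨hn, h⟩),
      firstReturnTime_eq_coe_iff.2 ⟨(Nat.find_spec hex).1, (Nat.find_spec hex).2, ?_⟩, h⟩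
    exact fun m hm hmk h0 => Nat.find_min hex hmk ⟨hm, h0⟩
  have hmeas : ∀ k : ℕ, NullMeasurableSet
      ({ω | firstReturnTime X ω = k} ∩ {ω | walk X n ω = 0}) μ := fun k =>
    (nullMeasurableSet_firstReturnTime hX k).inter
      ((aemeasurable_walk hX n).nullMeasurable (measurableSet_singleton (0 : ℤ)))
  have h1 : μ.real {ω | walk X n ω = 0} = ∑ k ∈ Finset.range (n + 1),
      μ.real ({ω | firstReturnTime X ω = k} ∩ {ω | walk X n ω = 0}) := by
    conv_lhs => rw [hunion]
    rw [measureReal_def, measure_biUnion_finset₀ ?_ fun k _ => hmeas k,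
      ENNReal.toReal_sum fun k _ => measure_ne_top _ _]
    · rfl
    · intro k _ m _ hkm
      refine Disjoint.aedisjoint (Set.disjoint_left.2 fun ω h2 h3 => hkm ?_)
      have : ((k : ℕ) : ℕ∞) = m := h2.1.symm.trans h3.1
      exact_mod_cast this
  rw [h1, Finset.Nat.sum_antidiagonal_eq_sum_range_succ_mk]
  refine Finset.sum_congr rfl fun k hk => ?_
  have hkn : k ≤ n := Nat.le_of_lt_succ (Finset.mem_range.1 hk)
  rw [measureReal_firstReturnTime_inter hindep hX hkn, hsum _ (Finset.range (n - k)) (by simp)]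
  rfl

end FirstReturn

/-! ### Aperiodicity of the walk and the symbol conditions -/

section Aperiodicity

open Real Topology

variable {Ω : Type*} [MeasurableSpace Ω] {μ : Measure Ω} {X : ℕ → Ω → ℤ}

/-- An event of positive probability meets every almost sure event; almost sure identities for the
increments can thus be tested on one sample path. -/
lemma exists_of_mem_possibleTimes {n : ℕ} {x : ℤ} (hn : n ∈ possibleTimes μ X x) {p : Ω → Prop}
    (hp : ∀ᵐ ω ∂μ, p ω) : ∃ ω, walk X n ω = x ∧ p ω := by
  by_contra! hcon
  have h1 : 0 < μ {ω | walk X n ω = x} := hn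
  refine h1.ne' (measure_mono_null (fun ω hω => ?_) (ae_iff.1 hp))
  exact hcon ω hω

variable [IsProbabilityMeasure μ]

/-- With zero variance every increment vanishes almost surely, and the site `1` is never reached. -/
lemma NoPeriodicity.variance_pos (hper : NoPeriodicity μ X)
    (hident : ∀ j, IdentDistrib (X j) (X 0) μ μ)
    (hfinite : MemLp (fun ω => (X 0 ω : ℝ)) 2 μ) (hmean : ∫ ω, (X 0 ω : ℝ) ∂μ = 0) :
    0 < variance (fun ω => (X 0 ω : ℝ)) μ := by
  refine lt_of_le_of_ne (variance_nonneg _ _) fun h0 => ?_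
  have h1 := ae_eq_integral_of_variance_eq_zero hfinite h0.symm
  have h2 : ∀ j, ∀ᵐ ω ∂μ, X j ω = 0 := fun j => by
    refine (hident j).symm.ae_snd (p := fun z : ℤ => z = 0) (measurableSet_singleton 0) ?_
    filter_upwards [h1] with ω hω
    rw [hmean] at hω
    exact_mod_cast hω
  obtain ⟨n, hn⟩ := hper.reaches_one
  obtain ⟨ω, hω, hω'⟩ := exists_of_mem_possibleTimes hn (ae_all_iff.2 h2)
  simp [walk, hω'] at hω

/-- If the norm were `1`, equality in the triangle inequality would force `e ^ (i θ X) = w` almost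
surely, hence `e ^ (i θ x) = w ^ n` whenever `S n = x` is possible. Return times have gcd `1`, so `w
= 1`; reaching the site `1` gives `e ^ (i θ) = 1`, impossible for `0 < |θ| ≤ π`. -/
lemma NoPeriodicity.norm_charFun_lt (hper : NoPeriodicity μ X)
    (hident : ∀ j, IdentDistrib (X j) (X 0) μ μ) {θ : ℝ} (hθ : θ ∈ Set.Icc (-π) π) (h0 : θ ≠ 0) :
    ‖charFun (μ.map fun ω => (X 0 ω : ℝ)) θ‖ < 1 := by
  have hpi := Real.pi_pos
  rw [charFun_map_intCast (hident 0).aemeasurable_fst]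
  have hle : ∀ᵐ ω ∂μ, ‖Complex.exp (X 0 ω * θ * Complex.I)‖ ≤ 1 := .of_forall fun ω => by
    rw [Complex.norm_exp]; simp
  rcases ae_eq_const_or_norm_integral_lt_of_norm_le_const hle with h | h
  swap
  · simpa using h
  exfalso
  set w := ⨍ ω, Complex.exp (X 0 ω * θ * Complex.I) ∂μ
  have h1 : ∀ j, ∀ᵐ ω ∂μ, Complex.exp (X j ω * θ * Complex.I) = w := fun j => by
    refine (hident j).symm.ae_snd (p := fun z : ℤ => Complex.exp (z * θ * Complex.I) = w)
      (Set.Countable.measurableSet (Set.to_countable _)) ?_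
    filter_upwards [h] with ω hω using hω
  have h2 : ∀ (n : ℕ) (x : ℤ), n ∈ possibleTimes μ X x →
      Complex.exp (x * θ * Complex.I) = w ^ n := fun n x hn => by
    obtain ⟨ω, hω, hω'⟩ := exists_of_mem_possibleTimes hn (ae_all_iff.2 h1)
    rw [← hω, walk]
    push_cast
    rw [Finset.sum_mul, Finset.sum_mul, Complex.exp_sum, Finset.prod_congr rfl fun j _ => hω' j]
    simp
  have hw : w = 1 := by
    have h3 : orderOf w ∣ Nat.setGcd (possibleTimes μ X 0) :=
      Nat.dvd_setGcd_iff.2 fun n hn => orderOf_dvd_of_pow_eq_one (by simpa using (h2 n 0 hn).symm)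
    rw [hper.gcd_returns, Nat.dvd_one, orderOf_eq_one_iff] at h3
    exact h3
  obtain ⟨n, hn⟩ := hper.reaches_one
  have h4 := h2 n 1 hn
  rw [hw, one_pow, Complex.exp_eq_one_iff] at h4
  obtain ⟨m, hm⟩ := h4
  have h5 : θ = m * (2 * π) := by
    have h6 : (θ : ℂ) = m * (2 * π) := by
      refine mul_right_cancel₀ Complex.I_ne_zero ?_
      rw [mul_assoc, ← hm]
      push_cast
      ring
    exact_mod_cast h6
  have hm0 : m = 0 := by
    by_contra hne
    have h7 : (1 : ℝ) ≤ |(m : ℝ)| := by exact_mod_cast Int.one_le_abs hne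
    have h8 : |θ| ≤ π := abs_le.2 hθ
    rw [h5, abs_mul, abs_of_pos (by positivity : (0 : ℝ) < 2 * π)] at h8
    nlinarith
  exact h0 (by rw [h5, hm0]; simp)

/-- A finite second moment makes the characteristic function `C²`, and for mean zero its second
order Taylor polynomial at `0` is `1 - (V / 2) θ ^ 2`. -/
lemma NoPeriodicity.isAperiodicSymbol_charFun (hper : NoPeriodicity μ X)
    (hident : ∀ j, IdentDistrib (X j) (X 0) μ μ)
    (hfinite : MemLp (fun ω => (X 0 ω : ℝ)) 2 μ) (hmean : ∫ ω, (X 0 ω : ℝ) ∂μ = 0) :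
    IsAperiodicSymbol (charFun (μ.map fun ω => (X 0 ω : ℝ)))
      (variance (fun ω => (X 0 ω : ℝ)) μ / 2) := by
  have hX : AEMeasurable (fun ω => (X 0 ω : ℝ)) μ := hfinite.aestronglyMeasurable.aemeasurable
  have : IsProbabilityMeasure (μ.map fun ω => (X 0 ω : ℝ)) := Measure.isProbabilityMeasure_map hX
  have hid : MemLp id 2 (μ.map fun ω => (X 0 ω : ℝ)) :=
    (memLp_map_measure_iff (by fun_prop) hX).2 hfinite
  refine ⟨continuous_charFun, half_pos (hper.variance_pos hident hfinite hmean),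
    fun θ hθ h0 => hper.norm_charFun_lt hident hθ h0, ?_⟩
  have h1 : ∀ t : ℝ, taylorWithinEval (charFun (μ.map fun ω => (X 0 ω : ℝ))) 2 Set.univ 0 t
      = 1 - ((variance (fun ω => (X 0 ω : ℝ)) μ / 2 : ℝ) : ℂ) * (t : ℂ) ^ 2 := fun t => by
    rw [taylorWithinEval_charFun_two_zero hX hid, hmean,
      variance_of_integral_eq_zero hX hmean]
    simp only [Pi.pow_apply]
    push_cast
    ring
  simp_rw [← h1]
  convert! taylor_isLittleO_univ (x₀ := (0 : ℝ)) (n := 2) (contDiff_charFun hid) using 1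
  simp

end Aperiodicity

/-! ### The asymptotics for the walk -/

theorem theorem2 {Ω : Type*} [MeasurableSpace Ω] (μ : Measure Ω) [IsProbabilityMeasure μ]
    (X : ℕ → Ω → ℤ) (V : ℝ)
    (hindep : iIndepFun X μ)
    (hident : ∀ j, IdentDistrib (X j) (X 0) μ μ)
    (hfinite : MemLp (fun ω => (X 0 ω : ℝ)) 2 μ)
    (hmean : ∫ ω, (X 0 ω : ℝ) ∂μ = 0)
    (hvar : variance (fun ω => (X 0 ω : ℝ)) μ = V)
    (hper : NoPeriodicity μ X) :
    (fun n : ℕ => firstReturnProb μ X n) ~[atTop]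
      (fun n : ℕ => Real.sqrt (V / (2 * Real.pi)) * (n : ℝ) ^ (-(3 / 2) : ℝ)) := by
  have h := hper.isAperiodicSymbol_charFun hident hfinite hmean
  have hV := hper.variance_pos hident hfinite hmean
  rw [hvar] at h hV
  have hlim := h.tendsto_first_return (u := fun n => μ.real {ω | walk X n ω = 0})
    (a := firstReturnProb μ X)
    (fun n => by
      have := measureReal_sum_eq_zero hindep hident (Finset.range n)
      rwa [Finset.card_range] at this)
    (fun n => by
      rw [firstReturnProb, abs_of_nonneg measureReal_nonneg]
      exact measureReal_le_one)
    (by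
      have : {ω | firstReturnTime X ω = (0 : ℕ)} = ∅ := Set.eq_empty_of_forall_notMem fun ω hω =>
        absurd (firstReturnTime_eq_coe_iff.1 hω).1 (by norm_num)
      rw [firstReturnProb, this, measureReal_empty])
    (fun n hn => renewal_equation hindep hident hn)
  -- With `b = V / 2` the constant `√(b / π)` becomes `√(V / (2 π))`.
  rw [div_div] at hlim
  have hc : 0 < Real.sqrt (V / (2 * Real.pi)) :=
    Real.sqrt_pos.2 (div_pos hV (by have := Real.pi_pos; positivity))
  have hne : ∀ᶠ n : ℕ in atTop,
      Real.sqrt (V / (2 * Real.pi)) * (n : ℝ) ^ (-(3 / 2) : ℝ) ≠ 0 := by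
    filter_upwards [eventually_gt_atTop 0] with n hn
    have : (0 : ℝ) < n := by exact_mod_cast hn
    positivity
  rw [isEquivalent_iff_tendsto_one hne]
  have h2 := hlim.div_const (Real.sqrt (V / (2 * Real.pi)))
  rw [div_self hc.ne'] at h2
  refine h2.congr fun n => ?_
  rw [Pi.div_apply, Real.rpow_neg (Nat.cast_nonneg n), ← div_eq_mul_inv, div_div_eq_mul_div]
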